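/- Let \(S=[0,1]^2\) be the unit square with Euclidean distance \(d\), and let \(\alpha>0\), \(c_1,c_2>0\) and \(0<\epsilon_1\le\epsilon_2<\infty\). Then there are a constant \(D_1=D_1(\alpha,c_1,c_2,\epsilon_1,\epsilon_2)>0\) and an integer \(n_0=n_0(\alpha,c_1,c_2,\epsilon_1,\epsilon_2)\) such that the following holds. Let \(f\) be a measurable probability density on \(S\) with \(\epsilon_1\le f(x)\le\epsilon_2\) for all \(x\in S\), let \(h:S\times S\to[0,\infty)\) be measurable with \(c_1 d(x,y)\le h(x,y)=h(y,x)\le c_2 d(x,y)\) for all \(x,y\in S\), and let \(X_1,X_2,\dots\) be i.i.d. random points of \(S\) with density \(f\). For \(n\ge1\) let \[ MST_n:=\min_{\mathcal T}\ \sum_{(X_i,X_j)\in\mathcal T} h(X_i,X_j)^{\alpha}, \] where the minimum is taken over all spanning trees \(\mathcal T\) of the complete graph on the nodes \(X_1,\dots,X_n\) and the sum over the edges of \(\mathcal T\). Then, for all \(n\ge n_0\), \(MST_n\) is square integrable and \[ \operatorname{Var}(MST_n)\le D_1\,n^{1-\alpha}. \] -/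

import Mathlib

open MeasureTheory ProbabilityTheory

noncomputable section

/-- The closed unit square `[0,1]²` in the Euclidean plane. As a type it carries the Euclidean
distance and the Borel σ-algebra. -/
def unitSquare : Set (EuclideanSpace ℝ (Fin 2)) :=
  {x | ∀ i, x i ∈ Set.Icc (0 : ℝ) 1}

/-- Lebesgue measure of the plane on the unit square. -/
def squareMeasure : Measure unitSquare :=
  (volume : Measure (EuclideanSpace ℝ (Fin 2))).comap Subtype.val

theorem measurableSet_unitSquare : MeasurableSet unitSquare := by
  have h : unitSquare = ⋂ i : Fin 2,
      (fun x : EuclideanSpace ℝ (Fin 2) => x i) ⁻¹' Set.Icc (0 : ℝ) 1 := by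
    ext x; simp [unitSquare]
  rw [h]
  exact MeasurableSet.iInter fun i => measurableSet_Icc.preimage (by fun_prop)

/-- `squareMeasure` is the restriction of Lebesgue measure to the square. -/
theorem map_squareMeasure :
    squareMeasure.map Subtype.val
      = (volume : Measure (EuclideanSpace ℝ (Fin 2))).restrict unitSquare :=
  map_comap_subtype_coe measurableSet_unitSquare _

open Classical in
/-- The weight of a graph `T` on the nodes `x 0, …, x (n - 1)`: the sum of `h (x i) (x j) ^ α`
over the edges `(i, j)`, `i < j`, of `T`. -/
def graphWeight (α : ℝ) (h : unitSquare → unitSquare → ℝ) {n : ℕ} (x : Fin n → unitSquare)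
    (T : SimpleGraph (Fin n)) : ℝ :=
  ∑ i : Fin n, ∑ j : Fin n, if i < j ∧ T.Adj i j then h (x i) (x j) ^ α else 0

/-- The weight of the minimum spanning tree of the complete graph on the nodes
`x 0, …, x (n - 1)` with edge weights `h ^ α`: the least weight of a tree on all `n` nodes. -/
def mstWeight (α : ℝ) (h : unitSquare → unitSquare → ℝ) {n : ℕ} (x : Fin n → unitSquare) : ℝ :=
  sInf (graphWeight α h x '' {T : SimpleGraph (Fin n) | T.IsTree})

/-- For at least one node the infimum is a minimum over spanning trees. -/
theorem mstWeight_isLeast (α : ℝ) (h : unitSquare → unitSquare → ℝ) {n : ℕ} (hn : 1 ≤ n)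
    (x : Fin n → unitSquare) :
    IsLeast (graphWeight α h x '' {T : SimpleGraph (Fin n) | T.IsTree}) (mstWeight α h x) := by
  have : Nonempty (Fin n) := ⟨⟨0, hn⟩⟩
  have hfin : (graphWeight α h x '' {T : SimpleGraph (Fin n) | T.IsTree}).Finite :=
    Set.toFinite _
  obtain ⟨T, -, hT⟩ := (SimpleGraph.connected_top (V := Fin n)).exists_isTree_le
  have hne : (graphWeight α h x '' {T : SimpleGraph (Fin n) | T.IsTree}).Nonempty :=
    ⟨_, T, hT, rfl⟩
  exact ⟨hne.csInf_mem hfin, fun _ hb => csInf_le hfin.bddBelow hb⟩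

end

section Graph

variable {V : Type*} [Fintype V]

open Classical in
/-- The sum of the weights of the edges of `G`, every edge being counted in both directions. -/
noncomputable def adjWeight (w : V → V → ℝ) (G : SimpleGraph V) : ℝ :=
  ∑ a, ∑ b, if G.Adj a b then w a b else 0

/-- `T` is connected and has the least weight among all connected graphs. -/
def IsMinConnected (w : V → V → ℝ) (T : SimpleGraph V) : Prop :=
  T.Connected ∧ ∀ G : SimpleGraph V, G.Connected → adjWeight w T ≤ adjWeight w G

theorem adjWeight_mono {w : V → V → ℝ} (hw : ∀ a b, 0 ≤ w a b) {G H : SimpleGraph V}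
    (hGH : G ≤ H) : adjWeight w G ≤ adjWeight w H := by
  classical
  refine Finset.sum_le_sum fun a _ => Finset.sum_le_sum fun b _ => ?_
  by_cases h : G.Adj a b
  · simp [h, hGH h]
  · simp only [h, if_false]
    split_ifs
    exacts [hw a b, le_rfl]

open Classical in
theorem sum_sum_pair (u : ℝ) (a b : V) :
    ∑ c, ∑ d, (if c = a ∧ d = b then u else 0) = u := by
  rw [Finset.sum_eq_single a]
  · simp
  · intro c _ hc; simp [hc]
  · simp

theorem adjWeight_sup_edge_le {w : V → V → ℝ} (hw : ∀ a b, 0 ≤ w a b)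
    (hs : ∀ a b, w a b = w b a) (G : SimpleGraph V) (a b : V) :
    adjWeight w (G ⊔ SimpleGraph.edge a b) ≤ adjWeight w G + 2 * w a b := by
  classical
  have key : adjWeight w G + 2 * w a b
      = ∑ c, ∑ d, ((if G.Adj c d then w c d else 0) + ((if c = a ∧ d = b then w a b else 0)
        + (if c = b ∧ d = a then w a b else 0))) := by
    simp only [Finset.sum_add_distrib, sum_sum_pair, adjWeight]
    ring
  rw [key]
  refine Finset.sum_le_sum fun c _ => Finset.sum_le_sum fun d _ => ?_
  have h1 := hw a b
  have h2 := hw c d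
  have h3 := hs a b
  simp only [SimpleGraph.sup_adj, SimpleGraph.edge_adj]
  grind

theorem adjWeight_deleteEdges_add {w : V → V → ℝ} (hs : ∀ a b, w a b = w b a)
    {G : SimpleGraph V} {a b : V} (hab : G.Adj a b) :
    adjWeight w (G.deleteEdges {s(a, b)}) + 2 * w a b = adjWeight w G := by
  classical
  have key : adjWeight w (G.deleteEdges {s(a, b)}) + 2 * w a b
      = ∑ c, ∑ d, ((if (G.deleteEdges {s(a, b)}).Adj c d then w c d else 0)
        + ((if c = a ∧ d = b then w a b else 0) + (if c = b ∧ d = a then w a b else 0))) := by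
    simp only [Finset.sum_add_distrib, sum_sum_pair, adjWeight]
    ring_nf
  rw [key]
  refine Finset.sum_congr rfl fun c _ => Finset.sum_congr rfl fun d _ => ?_
  have h3 := hs a b
  have h4 := hab.symm
  have h5 := hab.ne
  simp only [SimpleGraph.deleteEdges_adj, Set.mem_singleton_iff, Sym2.eq_iff]
  grind

theorem IsMinConnected.le_of_swap {w : V → V → ℝ} (hw : ∀ a b, 0 ≤ w a b)
    (hs : ∀ a b, w a b = w b a) {T : SimpleGraph V} (hT : IsMinConnected w T) {i j a b : V}
    (hij : T.Adj i j)
    (hc : (T.deleteEdges {s(i, j)} ⊔ SimpleGraph.edge a b).Connected) : w i j ≤ w a b := by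
  have h1 := hT.2 _ hc
  have h2 := adjWeight_sup_edge_le hw hs (T.deleteEdges {s(i, j)}) a b
  have h3 := adjWeight_deleteEdges_add hs hij
  linarith

omit [Fintype V] in
theorem reachable_deleteEdges_or {T : SimpleGraph V} (hT : T.Connected) (i j v : V) :
    (T.deleteEdges {s(i, j)}).Reachable v i ∨ (T.deleteEdges {s(i, j)}).Reachable v j := by
  obtain ⟨p⟩ := hT.preconnected v i
  induction p with
  | nil => exact Or.inl (SimpleGraph.Reachable.refl _)
  | @cons u v' w' huv p ih =>
    by_cases he : s(u, v') = s(w', j)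
    · rw [Sym2.eq_iff] at he
      rcases he with ⟨h1, -⟩ | ⟨h1, -⟩
      · exact Or.inl (h1 ▸ SimpleGraph.Reachable.refl _)
      · exact Or.inr (h1 ▸ SimpleGraph.Reachable.refl _)
    · have : (T.deleteEdges {s(w', j)}).Adj u v' := by
        simp [SimpleGraph.deleteEdges_adj, huv, he]
      exact ih.imp this.reachable.trans this.reachable.trans

omit [Fintype V] in
theorem connected_of_deleteEdges_le {T G : SimpleGraph V} (hT : T.Connected) {i j : V}
    (hle : T.deleteEdges {s(i, j)} ≤ G) (hij : G.Reachable i j) : G.Connected := by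
  have key : ∀ v, G.Reachable v j := fun v => by
    rcases reachable_deleteEdges_or hT i j v with h | h
    · exact (h.mono hle).trans hij
    · exact h.mono hle
  have := hT.nonempty
  exact SimpleGraph.Connected.mk fun a b => (key a).trans (key b).symm

/-- Two neighbours of a node are at least as far apart as each is from the node. -/
theorem IsMinConnected.le_of_adj_of_adj {w : V → V → ℝ} (hw : ∀ a b, 0 ≤ w a b)
    (hs : ∀ a b, w a b = w b a) {T : SimpleGraph V} (hT : IsMinConnected w T) {i j l : V}
    (hij : T.Adj i j) (hil : T.Adj i l) (hjl : j ≠ l) : w i j ≤ w l j := by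
  refine hT.le_of_swap hw hs hij (connected_of_deleteEdges_le hT.1 le_sup_left ?_)
  have h1 : (T.deleteEdges {s(i, j)} ⊔ SimpleGraph.edge l j).Adj i l := by
    have := hij.ne
    have := hil.ne
    simp only [SimpleGraph.sup_adj, SimpleGraph.deleteEdges_adj, Set.mem_singleton_iff,
      Sym2.eq_iff]
    grind
  have h2 : (T.deleteEdges {s(i, j)} ⊔ SimpleGraph.edge l j).Adj l j := by
    simp [SimpleGraph.edge_adj, hjl.symm]
  exact h1.reachable.trans h2.reachable

/-- Along every path joining the endpoints of an edge of a minimal connected graph, some step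
weighs at least as much as the edge. -/
theorem IsMinConnected.exists_step_ge {w : V → V → ℝ} (hw : ∀ a b, 0 ≤ w a b)
    (hs : ∀ a b, w a b = w b a) {T : SimpleGraph V} (hT : IsMinConnected w T) {i j : V}
    (hij : T.Adj i j) (hpos : 0 < w i j) (p : ℕ → V) (L : ℕ) (h0 : p 0 = i) (hL : p L = j) :
    ∃ t < L, w i j ≤ w (p t) (p (t + 1)) := by
  set D := T.deleteEdges {s(i, j)} with hD
  by_cases hall : ∀ t < L, D.Reachable (p t) (p (t + 1))
  · have hreach : ∀ t ≤ L, D.Reachable i (p t) := by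
      intro t
      induction t with
      | zero => intro _; rw [h0]
      | succ t ih => intro ht; exact (ih (by omega)).trans (hall t (by omega))
    have hc : D.Connected := connected_of_deleteEdges_le hT.1 le_rfl (hL ▸ hreach L le_rfl)
    have h1 := hT.2 _ hc
    have h3 := adjWeight_deleteEdges_add hs hij
    linarith
  · push Not at hall
    obtain ⟨t, ht, hnr⟩ := hall
    refine ⟨t, ht, hT.le_of_swap hw hs hij (connected_of_deleteEdges_le hT.1 le_sup_left ?_)⟩
    have hne : p t ≠ p (t + 1) := fun h => hnr (h ▸ SimpleGraph.Reachable.refl _)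
    have hadj : (D ⊔ SimpleGraph.edge (p t) (p (t + 1))).Reachable (p t) (p (t + 1)) := by
      refine SimpleGraph.Adj.reachable ?_
      simp [SimpleGraph.edge_adj, hne]
    have hle : D ≤ D ⊔ SimpleGraph.edge (p t) (p (t + 1)) := le_sup_left
    rcases reachable_deleteEdges_or hT.1 i j (p t) with h | h <;>
      rcases reachable_deleteEdges_or hT.1 i j (p (t + 1)) with h' | h'
    · exact absurd (h.trans h'.symm) hnr
    · exact ((h.mono hle).symm.trans hadj).trans (h'.mono hle)
    · exact ((h'.mono hle).symm.trans hadj.symm).trans (h.mono hle)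
    · exact absurd (h.trans h'.symm) hnr

open Classical in
/-- Moving the node `i` elsewhere: hand its neighbours over to one of them, `j`, and join `i`
to `k`. -/
theorem exists_connected_relocate {w w' : V → V → ℝ} (hw : ∀ a b, 0 ≤ w a b)
    (hw' : ∀ a b, 0 ≤ w' a b) (hs' : ∀ a b, w' a b = w' b a) {T : SimpleGraph V}
    (hT : T.Connected) {i j k : V} (hij : T.Adj i j) (hk : k ≠ i)
    (hww : ∀ a b, a ≠ i → b ≠ i → w' a b = w a b) :
    ∃ G : SimpleGraph V, G.Connected ∧ adjWeight w' G ≤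
      adjWeight w T + 2 * (∑ b, if T.Adj i b ∧ b ≠ j then w' j b else 0) + 2 * w' i k := by
  let r : V → V → Prop := fun a b =>
    (T.Adj a b ∧ a ≠ i ∧ b ≠ i) ∨ (a = j ∧ T.Adj i b) ∨ (a = i ∧ b = k)
  have hjr : ∀ b, T.Adj i b → (SimpleGraph.fromRel r).Reachable j b := by
    intro b hb
    by_cases h : j = b
    · rw [h]
    · exact SimpleGraph.Adj.reachable (by simp [r, h, hb])
  have hki : (SimpleGraph.fromRel r).Reachable i k :=
    SimpleGraph.Adj.reachable (by simp [r, hk.symm])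
  have hadj : ∀ a b, T.Adj a b → (SimpleGraph.fromRel r).Reachable (if a = i then j else a)
      (if b = i then j else b) := by
    intro a b hab
    by_cases ha : a = i <;> by_cases hb : b = i
    · simp [ha, hb]
    · simp only [ha, hb, if_true, if_false]
      exact hjr b (ha ▸ hab)
    · simp only [ha, hb, if_true, if_false]
      exact (hjr a (hb ▸ hab.symm)).symm
    · simp only [ha, hb, if_false]
      exact SimpleGraph.Adj.reachable (by simp [r, hab, hab.ne, ha, hb])
  have hreach : ∀ a b, (SimpleGraph.fromRel r).Reachable (if a = i then j else a)
      (if b = i then j else b) := by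
    intro a b
    obtain ⟨p⟩ := hT.preconnected a b
    induction p with
    | nil => exact SimpleGraph.Reachable.refl _
    | cons h p ih => exact (hadj _ _ h).trans ih
  have hj : ∀ a, (SimpleGraph.fromRel r).Reachable a j := by
    intro a
    by_cases ha : a = i
    · have := hreach k j
      simp only [hk, hij.ne.symm, if_false] at this
      exact ha ▸ hki.trans this
    · have := hreach a j
      simpa only [ha, hij.ne.symm, if_false] using this
  have := hT.nonempty
  refine ⟨SimpleGraph.fromRel r, SimpleGraph.Connected.mk fun a b => (hj a).trans (hj b).symm, ?_⟩
  have e1 : ∑ a, ∑ b, (if a = j ∧ T.Adj i b ∧ b ≠ j then w' j b else 0)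
      = ∑ b, if T.Adj i b ∧ b ≠ j then w' j b else 0 := by
    rw [Finset.sum_eq_single j]
    · simp
    · intro c _ hc; simp [hc]
    · simp
  have e2 : ∑ a, ∑ b, (if b = j ∧ T.Adj i a ∧ a ≠ j then w' j a else 0)
      = ∑ b, if T.Adj i b ∧ b ≠ j then w' j b else 0 := by
    rw [Finset.sum_comm, e1]
  have key : adjWeight w T + 2 * (∑ b, if T.Adj i b ∧ b ≠ j then w' j b else 0) + 2 * w' i k
      = ∑ a, ∑ b, ((if T.Adj a b then w a b else 0)
        + ((if a = j ∧ T.Adj i b ∧ b ≠ j then w' j b else 0)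
          + (if b = j ∧ T.Adj i a ∧ a ≠ j then w' j a else 0))
        + ((if a = i ∧ b = k then w' i k else 0) + (if a = k ∧ b = i then w' i k else 0))) := by
    simp only [Finset.sum_add_distrib, sum_sum_pair, e1, e2, adjWeight]
    ring
  rw [key]
  refine Finset.sum_le_sum fun a _ => Finset.sum_le_sum fun b _ => ?_
  have n1 : 0 ≤ (if T.Adj a b then w a b else 0) := by split_ifs; exacts [hw a b, le_rfl]
  have n2 : 0 ≤ (if a = j ∧ T.Adj i b ∧ b ≠ j then w' j b else 0) := by
    split_ifs; exacts [hw' j b, le_rfl]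
  have n3 : 0 ≤ (if b = j ∧ T.Adj i a ∧ a ≠ j then w' j a else 0) := by
    split_ifs; exacts [hw' j a, le_rfl]
  have n4 : 0 ≤ (if a = i ∧ b = k then w' i k else 0) := by split_ifs; exacts [hw' i k, le_rfl]
  have n5 : 0 ≤ (if a = k ∧ b = i then w' i k else 0) := by split_ifs; exacts [hw' i k, le_rfl]
  by_cases hG : (SimpleGraph.fromRel r).Adj a b
  · simp only [hG, if_true]
    obtain ⟨hne, hr⟩ := hG
    have c1 : T.Adj a b → a ≠ i → b ≠ i → w' a b ≤ (if T.Adj a b then w a b else 0) := by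
      intro h1 h2 h3; simp [h1, hww a b h2 h3]
    have c2 : a = j → T.Adj i b → w' a b ≤
        (if a = j ∧ T.Adj i b ∧ b ≠ j then w' j b else 0) := by
      intro h1 h2; subst h1; simp [h2, hne.symm]
    have c3 : b = j → T.Adj i a → w' a b ≤
        (if b = j ∧ T.Adj i a ∧ a ≠ j then w' j a else 0) := by
      intro h1 h2; subst h1; simp [h2, hne, hs' a b]
    have c4 : a = i → b = k → w' a b ≤ (if a = i ∧ b = k then w' i k else 0) := by
      intro h1 h2; subst h1 h2; simp
    have c5 : a = k → b = i → w' a b ≤ (if a = k ∧ b = i then w' i k else 0) := by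
      intro h1 h2; subst h1 h2; simp [hs' a b]
    rcases hr with (⟨h1, h2, h3⟩ | ⟨h1, h2⟩ | ⟨h1, h2⟩) | (⟨h1, h2, h3⟩ | ⟨h1, h2⟩ | ⟨h1, h2⟩)
    · linarith [c1 h1 h2 h3]
    · linarith [c2 h1 h2]
    · linarith [c4 h1 h2]
    · linarith [c1 h1.symm h3 h2]
    · linarith [c3 h1 h2]
    · linarith [c5 h2 h1]
  · simp only [hG, if_false]
    linarith

end Graph

section MST

variable {α : ℝ} {h : unitSquare → unitSquare → ℝ}

theorem adjWeight_eq_two_mul_graphWeight (hs : ∀ x y, h x y = h y x) {n : ℕ}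
    (x : Fin n → unitSquare) (T : SimpleGraph (Fin n)) :
    adjWeight (fun a b => h (x a) (x b) ^ α) T = 2 * graphWeight α h x T := by
  classical
  have e : graphWeight α h x T
      = ∑ i : Fin n, ∑ j : Fin n, if j < i ∧ T.Adj i j then h (x i) (x j) ^ α else 0 := by
    unfold graphWeight
    rw [Finset.sum_comm]
    refine Finset.sum_congr rfl fun i _ => Finset.sum_congr rfl fun j _ => ?_
    rw [hs (x j) (x i), T.adj_comm j i]
  rw [two_mul]
  nth_rewrite 2 [e]
  unfold graphWeight adjWeight
  simp only [← Finset.sum_add_distrib]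
  refine Finset.sum_congr rfl fun i _ => Finset.sum_congr rfl fun j _ => ?_
  by_cases hij : T.Adj i j
  · rcases lt_or_gt_of_ne hij.ne with h1 | h1
    · simp [hij, h1, h1.not_gt]
    · simp [hij, h1, h1.not_gt]
  · simp [hij]

theorem two_mul_mstWeight_le (hs : ∀ x y, h x y = h y x) (h0 : ∀ x y, 0 ≤ h x y) {n : ℕ}
    (hn : 1 ≤ n) (x : Fin n → unitSquare) {G : SimpleGraph (Fin n)} (hG : G.Connected) :
    2 * mstWeight α h x ≤ adjWeight (fun a b => h (x a) (x b) ^ α) G := by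
  obtain ⟨T, hTG, hT⟩ := hG.exists_isTree_le
  refine le_trans ?_ (adjWeight_mono (fun a b => Real.rpow_nonneg (h0 _ _) _) hTG)
  rw [adjWeight_eq_two_mul_graphWeight hs]
  linarith [(mstWeight_isLeast α h hn x).2 ⟨T, hT, rfl⟩]

theorem exists_isMinConnected (hs : ∀ x y, h x y = h y x) (h0 : ∀ x y, 0 ≤ h x y) {n : ℕ}
    (hn : 1 ≤ n) (x : Fin n → unitSquare) : ∃ T : SimpleGraph (Fin n),
      IsMinConnected (fun a b => h (x a) (x b) ^ α) T ∧
      adjWeight (fun a b => h (x a) (x b) ^ α) T = 2 * mstWeight α h x := by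
  obtain ⟨T, hT, hTe⟩ := (mstWeight_isLeast α h hn x).1
  have e : adjWeight (fun a b => h (x a) (x b) ^ α) T = 2 * mstWeight α h x := by
    rw [adjWeight_eq_two_mul_graphWeight hs, hTe]
  refine ⟨T, ⟨hT.connected, fun G hG => ?_⟩, e⟩
  rw [e]
  exact two_mul_mstWeight_le hs h0 hn x hG

end MST

section Plane

theorem abs_coord_sub_le_dist (a b : EuclideanSpace ℝ (Fin 2)) (c : Fin 2) :
    |a c - b c| ≤ dist a b := by
  rw [dist_eq_norm]
  simpa using PiLp.norm_apply_le (a - b) c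

theorem dist_le_of_forall_coord {a b : EuclideanSpace ℝ (Fin 2)} {r : ℝ} (hr : 0 ≤ r)
    (hab : ∀ c, |a c - b c| ≤ r / 2) : dist a b ≤ r := by
  rw [EuclideanSpace.dist_eq]
  refine Real.sqrt_le_iff.2 ⟨hr, ?_⟩
  rw [Fin.sum_univ_two]
  have key : ∀ c, dist (a c) (b c) ^ 2 ≤ (r / 2) ^ 2 := fun c =>
    pow_le_pow_left₀ dist_nonneg (by rw [Real.dist_eq]; exact hab c) 2
  nlinarith [key 0, key 1]

theorem dist_unitSquare_lt_two (a b : unitSquare) : dist a b < 2 := by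
  have h : dist a b ^ 2 ≤ 2 := by
    rw [Subtype.dist_eq, EuclideanSpace.dist_eq, Real.sq_sqrt (by positivity), Fin.sum_univ_two]
    have key : ∀ c, dist ((a : EuclideanSpace ℝ (Fin 2)) c) ((b : EuclideanSpace ℝ (Fin 2)) c) ^ 2
        ≤ 1 := fun c => by
      have h1 := a.2 c
      have h2 := b.2 c
      rw [Real.dist_eq, sq_abs]
      nlinarith [h1.1, h1.2, h2.1, h2.2]
    linarith [key 0, key 1]
  nlinarith [dist_nonneg (x := a) (y := b)]

/-- The nearest point of the unit square. -/
noncomputable def clampSquare (z : EuclideanSpace ℝ (Fin 2)) : unitSquare :=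
  ⟨WithLp.toLp 2 fun c => max 0 (min 1 (z c)), fun _ =>
    ⟨le_max_left _ _, max_le zero_le_one (min_le_left _ _)⟩⟩

theorem clampSquare_apply (z : EuclideanSpace ℝ (Fin 2)) (c : Fin 2) :
    (clampSquare z : EuclideanSpace ℝ (Fin 2)) c = max 0 (min 1 (z c)) := rfl

theorem clampSquare_coe (z : unitSquare) : clampSquare z = z := by
  refine Subtype.ext (PiLp.ext fun c => ?_)
  have h := z.2 c
  rw [clampSquare_apply, min_eq_right h.2, max_eq_right h.1]

theorem abs_clampSquare_sub_le (z : EuclideanSpace ℝ (Fin 2)) (y : unitSquare) (c : Fin 2) :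
    |(clampSquare z : EuclideanSpace ℝ (Fin 2)) c - (y : EuclideanSpace ℝ (Fin 2)) c|
      ≤ |z c - (y : EuclideanSpace ℝ (Fin 2)) c| := by
  have h := y.2 c
  rw [clampSquare_apply]
  rcases le_total (z c) 0 with h1 | h1
  · rw [min_eq_right (by linarith), max_eq_left h1, abs_sub_comm, abs_sub_comm (z c),
      abs_of_nonneg (by linarith [h.1]), abs_of_nonneg (by linarith [h.1])]
    linarith
  · rcases le_total (z c) 1 with h2 | h2
    · rw [min_eq_right h2, max_eq_right h1]
    · rw [min_eq_left h2, max_eq_right zero_le_one, abs_of_nonneg (by linarith [h.2]),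
        abs_of_nonneg (by linarith [h.2])]
      linarith

theorem measurable_clampSquare : Measurable clampSquare := by
  refine Measurable.subtype_mk ?_
  refine (WithLp.measurable_toLp 2 _).comp ?_
  exact measurable_pi_lambda _ fun c => by fun_prop

/-- The offsets of the test points around a given point. -/
noncomputable def offsets (L : ℕ) : Finset (Fin 2 → ℤ) :=
  Fintype.piFinset fun _ => Finset.Icc (-(2 * L : ℤ)) (2 * L)

/-- The node at offset `v` of a grid of mesh `s / L` centred at `z`, moved into the square. -/
noncomputable def testPoint (L : ℕ) (s : ℝ) (v : Fin 2 → ℤ) (z : unitSquare) : unitSquare :=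
  clampSquare ((z : EuclideanSpace ℝ (Fin 2)) + WithLp.toLp 2 fun c => s / L * (v c : ℝ))

theorem testPoint_zero (L : ℕ) (s : ℝ) (z : unitSquare) : testPoint L s 0 z = z := by
  have : (WithLp.toLp 2 fun c => s / L * ((0 : Fin 2 → ℤ) c : ℝ) : EuclideanSpace ℝ (Fin 2)) = 0 := by
    ext c; simp
  rw [testPoint, this, add_zero, clampSquare_coe]

theorem measurable_testPoint (L : ℕ) (s : ℝ) (v : Fin 2 → ℤ) : Measurable (testPoint L s v) :=
  measurable_clampSquare.comp (measurable_subtype_coe.add_const _)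

theorem exists_testPoint_near {L : ℕ} (hL : 0 < L) {s : ℝ} (hs : 0 < s) {x z : unitSquare}
    (hxz : dist x z ≤ 2 * s) : ∃ v ∈ offsets L, dist (testPoint L s v x) z ≤ s / L := by
  have hL' : (0 : ℝ) < L := Nat.cast_pos.2 hL
  have hm : 0 < s / L := div_pos hs hL'
  let u : Fin 2 → ℝ := fun c =>
    ((z : EuclideanSpace ℝ (Fin 2)) c - (x : EuclideanSpace ℝ (Fin 2)) c) / (s / L)
  have hu : ∀ c, |u c| ≤ 2 * L := by
    intro c
    have h1 := abs_coord_sub_le_dist (x : EuclideanSpace ℝ (Fin 2)) z c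
    rw [abs_sub_comm] at h1
    rw [abs_div, abs_of_pos hm, div_le_iff₀ hm]
    have : 2 * (L : ℝ) * (s / L) = 2 * s := by field_simp
    rw [this]
    exact h1.trans hxz
  refine ⟨fun c => round (u c), ?_, ?_⟩
  · refine Fintype.mem_piFinset.2 fun c => Finset.mem_Icc.2 ?_
    have h1 := abs_le.1 (abs_sub_round (u c))
    have h2 := abs_le.1 (hu c)
    have h3 : (-(2 * L : ℤ) - 1 : ℝ) < round (u c) := by push_cast; linarith
    have h4 : (round (u c) : ℝ) < ((2 * L : ℤ) + 1 : ℝ) := by push_cast; linarith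
    have h5 : -(2 * L : ℤ) - 1 < round (u c) := by exact_mod_cast h3
    have h6 : round (u c) < (2 * L : ℤ) + 1 := by exact_mod_cast h4
    constructor <;> omega
  · refine dist_le_of_forall_coord hm.le fun c => (abs_clampSquare_sub_le _ _ _).trans ?_
    have h1 := abs_sub_round (u c)
    have h2 : ((x : EuclideanSpace ℝ (Fin 2)) + WithLp.toLp 2 fun c => s / L * (round (u c) : ℝ)) c
        - (z : EuclideanSpace ℝ (Fin 2)) c = -(s / L * (u c - round (u c))) := by
      have : s / L * u c = (z : EuclideanSpace ℝ (Fin 2)) c - (x : EuclideanSpace ℝ (Fin 2)) c :=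
        mul_div_cancel₀ _ hm.ne'
      rw [mul_sub, this, PiLp.add_apply]
      ring
    rw [h2, abs_neg, abs_mul, abs_of_pos hm]
    nlinarith

/-- Points at mutual distances at least `κ` times their distance to `o` have a sum of powers of
distances to `o` comparable to the largest one. -/
theorem exists_sum_rpow_dist_le {α κ : ℝ} (hα : 0 < α) (hκ : 0 < κ) :
    ∃ C : ℝ, 0 < C ∧ ∀ (ι : Type) (N : Finset ι) (y : ι → EuclideanSpace ℝ (Fin 2))
      (o : EuclideanSpace ℝ (Fin 2)) (R : ℝ), 0 ≤ R → (∀ j ∈ N, dist (y j) o ≤ R) →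
      (∀ j ∈ N, ∀ l ∈ N, j ≠ l → κ * dist (y j) o ≤ dist (y j) (y l)) →
      ∑ j ∈ N, dist (y j) o ^ α ≤ C * R ^ α := by
  classical
  obtain ⟨A, hA⟩ := exists_nat_gt (4 / κ)
  have hA0 : (0 : ℝ) < A := (by positivity : (0 : ℝ) < 4 / κ).trans hA
  let W : Finset (Fin 2 → ℤ) := Fintype.piFinset fun _ => Finset.Icc (-(A : ℤ)) A
  have hq0 : (0 : ℝ) ≤ (1 / 2 : ℝ) ^ α := by positivity
  have hq1 : (1 / 2 : ℝ) ^ α < 1 := Real.rpow_lt_one (by norm_num) (by norm_num) hα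
  have hW : 0 < W.card := by
    refine Finset.card_pos.2 ⟨0, Fintype.mem_piFinset.2 fun c => Finset.mem_Icc.2 ?_⟩
    simp
  refine ⟨W.card * (1 - (1 / 2 : ℝ) ^ α)⁻¹, mul_pos (Nat.cast_pos.2 hW)
    (inv_pos.2 (by linarith)), ?_⟩
  intro ι N y o R hR hN hsep
  rcases hR.eq_or_lt with rfl | hR
  · rw [Finset.sum_eq_zero, Real.zero_rpow hα.ne', mul_zero]
    intro j hj
    rw [le_antisymm (hN j hj) dist_nonneg, Real.zero_rpow hα.ne']
  have hlev : ∀ j : ι, ∃ k : ℕ, j ∈ N → 0 < dist (y j) o →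
      R * (1 / 2 : ℝ) ^ (k + 1) < dist (y j) o ∧ dist (y j) o ≤ R * (1 / 2 : ℝ) ^ k := by
    intro j
    by_cases hj : j ∈ N ∧ 0 < dist (y j) o
    · obtain ⟨k, h1, h2⟩ := exists_nat_pow_near_of_lt_one (div_pos hj.2 hR)
        ((div_le_one hR).2 (hN j hj.1)) (by norm_num : (0 : ℝ) < 1 / 2) (by norm_num)
      refine ⟨k, fun _ _ => ⟨?_, ?_⟩⟩
      · rwa [lt_div_iff₀' hR] at h1
      · rwa [div_le_iff₀' hR] at h2
    · exact ⟨0, fun h1 h2 => absurd ⟨h1, h2⟩ hj⟩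
  choose k hk using hlev
  let m : ι → ℝ := fun j => R * (1 / 2 : ℝ) ^ k j / A
  have hm : ∀ j, 0 < m j := fun j => by positivity
  let q : ι → Fin 2 → ℤ := fun j c => ⌊(y j c - o c) / m j⌋
  set N' := N.filter fun j => 0 < dist (y j) o with hN'
  let K := N'.sup k + 1
  have hsum : ∑ j ∈ N, dist (y j) o ^ α = ∑ j ∈ N', dist (y j) o ^ α := by
    refine (Finset.sum_subset (Finset.filter_subset _ _) fun j hj hj' => ?_).symm
    have : dist (y j) o = 0 := by
      by_contra h
      exact hj' (Finset.mem_filter.2 ⟨hj, lt_of_le_of_ne dist_nonneg (Ne.symm h)⟩)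
    rw [this, Real.zero_rpow hα.ne']
  have hinj : Set.InjOn (fun j => (k j, q j)) (N' : Set ι) := by
    intro j hj l hl hjl
    by_contra hne
    obtain ⟨hj1, hj2⟩ := Finset.mem_filter.1 (Finset.mem_coe.1 hj)
    obtain ⟨hl1, hl2⟩ := Finset.mem_filter.1 (Finset.mem_coe.1 hl)
    obtain ⟨e1, e2⟩ := Prod.mk.inj hjl
    have hmm : m l = m j := by simp only [m, e1]
    have hd : dist (y j) (y l) ≤ 2 * m j := by
      refine dist_le_of_forall_coord (by linarith [hm j]) fun c => ?_
      have h3 : ⌊(y j c - o c) / m j⌋ = ⌊(y l c - o c) / m j⌋ := by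
        have := congrFun e2 c
        simp only [q, hmm] at this
        exact this
      have h4 := Int.abs_sub_lt_one_of_floor_eq_floor h3
      rw [← sub_div, abs_div, abs_of_pos (hm j), div_lt_one (hm j)] at h4
      have h5 : y j c - y l c = y j c - o c - (y l c - o c) := by ring
      rw [h5]
      linarith
    have h6 := hsep j hj1 l hl1 hne
    have h7 := (hk j hj1 hj2).1
    have h8 : 4 < A * κ := (div_lt_iff₀ hκ).1 hA
    have h9 : R * (1 / 2 : ℝ) ^ (k j + 1) = m j * A / 2 := by
      simp only [m]
      field_simp
      ring
    rw [h9] at h7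
    have h10 : κ * (m j * A / 2) < 2 * m j := by nlinarith
    nlinarith [hm j]
  have hmaps : ∀ j ∈ N', (k j, q j) ∈ Finset.range K ×ˢ W := by
    intro j hj
    obtain ⟨hj1, hj2⟩ := Finset.mem_filter.1 hj
    refine Finset.mem_product.2 ⟨Finset.mem_range.2 (Nat.lt_succ_of_le (Finset.le_sup hj)),
      Fintype.mem_piFinset.2 fun c => Finset.mem_Icc.2 ?_⟩
    have h1 := abs_coord_sub_le_dist (y j) o c
    have h2 : |(y j c - o c) / m j| ≤ A := by
      rw [abs_div, abs_of_pos (hm j), div_le_iff₀ (hm j)]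
      have : (A : ℝ) * m j = R * (1 / 2 : ℝ) ^ k j := by simp only [m]; field_simp
      rw [this]
      exact h1.trans (hk j hj1 hj2).2
    obtain ⟨h3, h4⟩ := abs_le.1 h2
    refine ⟨Int.le_floor.2 (by push_cast; exact h3), ?_⟩
    have h5 : (⌊(y j c - o c) / m j⌋ : ℝ) ≤ A := (Int.floor_le _).trans h4
    exact_mod_cast h5
  calc ∑ j ∈ N, dist (y j) o ^ α = ∑ j ∈ N', dist (y j) o ^ α := hsum
    _ ≤ ∑ j ∈ N', (R * (1 / 2 : ℝ) ^ k j) ^ α := by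
        refine Finset.sum_le_sum fun j hj => ?_
        obtain ⟨hj1, hj2⟩ := Finset.mem_filter.1 hj
        exact Real.rpow_le_rpow dist_nonneg (hk j hj1 hj2).2 hα.le
    _ = ∑ p ∈ N'.image fun j => (k j, q j), (R * (1 / 2 : ℝ) ^ p.1) ^ α :=
        (Finset.sum_image (f := fun p : ℕ × (Fin 2 → ℤ) => (R * (1 / 2 : ℝ) ^ p.1) ^ α) hinj).symm
    _ ≤ ∑ p ∈ Finset.range K ×ˢ W, (R * (1 / 2 : ℝ) ^ p.1) ^ α := by
        refine Finset.sum_le_sum_of_subset_of_nonneg (Finset.image_subset_iff.2 hmaps)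
          fun p _ _ => by positivity
    _ = W.card * R ^ α * ∑ i ∈ Finset.range K, ((1 / 2 : ℝ) ^ α) ^ i := by
        rw [Finset.sum_product, Finset.mul_sum]
        refine Finset.sum_congr rfl fun i _ => ?_
        dsimp only
        rw [Finset.sum_const, nsmul_eq_mul, Real.mul_rpow hR.le (by positivity),
          ← Real.rpow_natCast, ← Real.rpow_natCast, ← Real.rpow_mul (by norm_num),
          ← Real.rpow_mul (by norm_num), mul_comm α, mul_assoc]
    _ ≤ W.card * R ^ α * (1 - (1 / 2 : ℝ) ^ α)⁻¹ := by
        refine mul_le_mul_of_nonneg_left ?_ (by positivity)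
        rw [← tsum_geometric_of_lt_one hq0 hq1]
        exact (summable_geometric_of_lt_one hq0 hq1).sum_le_tsum _ fun _ _ => by positivity
    _ = _ := by ring

end Plane

section Vacancy

/-- Some test ball of radius `s / L` near `z` contains none of the points `x l`, `l ≠ i`. -/
def HasVacantBall (L : ℕ) {n : ℕ} (x : Fin n → unitSquare) (i : Fin n) (z : unitSquare) (s : ℝ) :
    Prop :=
  ∃ v ∈ offsets L, ∀ l, l ≠ i → s / L < dist (x l) (testPoint L s v z)

theorem hasVacantBall_update {L n : ℕ} {x : Fin n → unitSquare} {i : Fin n} {y z : unitSquare}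
    {s : ℝ} : HasVacantBall L (Function.update x i y) i z s ↔ HasVacantBall L x i z s := by
  refine exists_congr fun v => and_congr_right fun _ => forall_congr' fun l => ?_
  refine forall_congr' fun hl => ?_
  rw [Function.update_of_ne hl]

/-- At every scale comparable to `R` there is a vacant ball near `z`. -/
def IsVacantRadius (L : ℕ) {n : ℕ} (x : Fin n → unitSquare) (i : Fin n) (z : unitSquare) (R : ℝ) :
    Prop :=
  0 ≤ R ∧ R < 2 ∧ ∀ s, 0 < s → s ≤ R → R < 2 * s → HasVacantBall L x i z s

/-- The `k`-th dyadic scale for `n` points. -/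
noncomputable def scale (n k : ℕ) : ℝ := 2 ^ k / √n

open Classical in
/-- The squares of the powers of the dyadic scales having a vacant ball near `z`. -/
noncomputable def vacancySum (α : ℝ) (L : ℕ) {n : ℕ} (x : Fin n → unitSquare) (i : Fin n)
    (z : unitSquare) : ℝ :=
  ((1 / √n) ^ α) ^ 2 * (1 + ∑ k ∈ Finset.range (2 * n + 1),
    if scale n k ≤ 2 ∧ HasVacantBall L x i z (scale n k) then (((2 : ℝ) ^ (k + 1)) ^ α) ^ 2 else 0)

theorem vacancySum_nonneg (α : ℝ) (L : ℕ) {n : ℕ} (x : Fin n → unitSquare) (i : Fin n)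
    (z : unitSquare) : 0 ≤ vacancySum α L x i z := by
  classical
  refine mul_nonneg (by positivity) (add_nonneg zero_le_one (Finset.sum_nonneg fun k _ => ?_))
  split_ifs <;> positivity

theorem vacancySum_update {α : ℝ} {L n : ℕ} {x : Fin n → unitSquare} {i : Fin n}
    {y z : unitSquare} : vacancySum α L (Function.update x i y) i z = vacancySum α L x i z := by
  classical
  refine congrArg (fun u => ((1 / √n) ^ α) ^ 2 * (1 + u)) (Finset.sum_congr rfl fun k _ => ?_)
  exact if_congr (and_congr_right fun _ => hasVacantBall_update) rfl rfl

theorem IsVacantRadius.rpow_sq_le {α : ℝ} (hα : 0 < α) {L n : ℕ} (hn : 1 ≤ n)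
    {x : Fin n → unitSquare} {i : Fin n} {z : unitSquare} {R : ℝ} (hR : IsVacantRadius L x i z R) :
    (R ^ α) ^ 2 ≤ vacancySum α L x i z := by
  classical
  obtain ⟨hR0, hR2, hR⟩ := hR
  have hn1 : (1 : ℝ) ≤ n := by exact_mod_cast hn
  have hsn : (0 : ℝ) < √n := Real.sqrt_pos.2 (by linarith)
  have hnonneg : ∀ k ∈ Finset.range (2 * n + 1), (0 : ℝ) ≤
      if scale n k ≤ 2 ∧ HasVacantBall L x i z (scale n k)
        then (((2 : ℝ) ^ (k + 1)) ^ α) ^ 2 else 0 := by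
    intro k _
    split_ifs <;> positivity
  unfold vacancySum
  by_cases h1 : R ≤ 1 / √n
  · calc (R ^ α) ^ 2 ≤ ((1 / √n) ^ α) ^ 2 * 1 := by
          rw [mul_one]
          gcongr
      _ ≤ _ := by
          gcongr
          linarith [Finset.sum_nonneg hnonneg]
  · push Not at h1
    obtain ⟨k, hk1, hk2⟩ := exists_nat_pow_near (x := R * √n) (y := 2)
      ((div_lt_iff₀ hsn).1 h1).le (by norm_num)
    have hs1 : scale n k ≤ R := (div_le_iff₀ hsn).2 hk1
    have hs2 : R < 2 * scale n k := by
      rw [scale, ← mul_div_assoc, lt_div_iff₀ hsn]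
      rw [pow_succ] at hk2
      linarith
    have hs0 : 0 < scale n k := by unfold scale; positivity
    have hkn : k ∈ Finset.range (2 * n + 1) := by
      rw [Finset.mem_range]
      have h3 : (2 : ℝ) ^ k ≤ 2 * n := by
        have : √n ≤ n := by
          rw [Real.sqrt_le_left (by linarith)]
          nlinarith
        nlinarith
      have h4 : 2 ^ k ≤ 2 * n := by exact_mod_cast h3
      have := Nat.lt_two_pow_self (n := k)
      omega
    have hterm := Finset.single_le_sum hnonneg hkn
    rw [if_pos ⟨by linarith, hR _ hs0 hs1 hs2⟩] at hterm
    calc (R ^ α) ^ 2 ≤ ((1 / √n * 2 ^ (k + 1)) ^ α) ^ 2 := by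
          gcongr
          rw [div_mul_eq_mul_div, one_mul, le_div_iff₀ hsn]
          exact hk2.le
      _ = ((1 / √n) ^ α) ^ 2 * (((2 : ℝ) ^ (k + 1)) ^ α) ^ 2 := by
          rw [Real.mul_rpow (by positivity) (by positivity), mul_pow]
      _ ≤ _ := by
          gcongr
          linarith

end Vacancy

section Relocation

variable {α c₁ c₂ : ℝ} {h : unitSquare → unitSquare → ℝ}

/-- The length of an edge of a minimum spanning tree is a vacant radius at its endpoints. -/
theorem isVacantRadius_of_adj (hα : 0 < α) (hc₁ : 0 < c₁) (hc₂ : 0 < c₂)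
    (hs : ∀ x y, h x y = h y x)
    (hd : ∀ x y, c₁ * dist x y ≤ h x y ∧ h x y ≤ c₂ * dist x y) {L : ℕ} (hL0 : 0 < L)
    (hL : 5 * c₂ < c₁ * L) {n : ℕ} {x : Fin n → unitSquare} {T : SimpleGraph (Fin n)}
    (hT : IsMinConnected (fun a b => h (x a) (x b) ^ α) T) {i j : Fin n} (hij : T.Adj i j) :
    IsVacantRadius L x i (x i) (dist (x i) (x j)) := by
  refine ⟨dist_nonneg, dist_unitSquare_lt_two _ _, fun s hs0 hsR hRs => ?_⟩
  by_contra hcon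
  unfold HasVacantBall at hcon
  push Not at hcon
  set R := dist (x i) (x j) with hR
  have hL' : (0 : ℝ) < L := Nat.cast_pos.2 hL0
  have h0 : ∀ a b, 0 ≤ h a b := fun a b => (by positivity : 0 ≤ c₁ * dist a b).trans (hd a b).1
  let z : ℕ → EuclideanSpace ℝ (Fin 2) := fun t =>
    AffineMap.lineMap (x i : EuclideanSpace ℝ (Fin 2)) (x j) ((t : ℝ) / L)
  have hz : ∀ t ≤ L, z t ∈ unitSquare := by
    intro t ht c
    have h1 : (0 : ℝ) ≤ (t : ℝ) / L := by positivity
    have h2 : (t : ℝ) / L ≤ 1 := (div_le_one hL').2 (by exact_mod_cast ht)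
    have e : z t c = (1 - (t : ℝ) / L) * (x i : EuclideanSpace ℝ (Fin 2)) c
        + (t : ℝ) / L * (x j : EuclideanSpace ℝ (Fin 2)) c := by
      simp [z, AffineMap.lineMap_apply]
      ring
    have hi := (x i).2 c
    have hj := (x j).2 c
    rw [e]
    constructor
    · have := mul_nonneg (sub_nonneg.2 h2) hi.1
      have := mul_nonneg h1 hj.1
      linarith
    · nlinarith [mul_le_mul_of_nonneg_left hi.2 (sub_nonneg.2 h2),
        mul_le_mul_of_nonneg_left hj.2 h1]
  have hz0 : z 0 = x i := by simp [z]
  have hzL : z L = x j := by simp [z, hL'.ne']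
  have hrep : ∀ t, ∃ l, (t ≤ L → dist (x l : EuclideanSpace ℝ (Fin 2)) (z t) ≤ 2 * (s / L))
      ∧ (t = 0 → l = i) ∧ (t = L → l = j) := by
    intro t
    by_cases ht0 : t = 0
    · refine ⟨i, fun _ => ?_, fun _ => rfl, fun h => by omega⟩
      rw [ht0, hz0, dist_self]
      positivity
    by_cases htL : t = L
    · refine ⟨j, fun _ => ?_, fun h => by omega, fun _ => rfl⟩
      rw [htL, hzL, dist_self]
      positivity
    by_cases ht : t ≤ L
    · have hdz : dist (x i) (⟨z t, hz t ht⟩ : unitSquare) ≤ 2 * s := by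
        have h2 : (t : ℝ) / L ≤ 1 := (div_le_one hL').2 (by exact_mod_cast ht)
        have h3 : dist (x i : EuclideanSpace ℝ (Fin 2)) (z t) ≤ R := by
          simp only [z, dist_left_lineMap, Real.norm_eq_abs]
          rw [abs_of_nonneg (by positivity)]
          exact mul_le_of_le_one_left dist_nonneg h2
        exact (h3.trans hRs.le)
      obtain ⟨v, hv, hvz⟩ := exists_testPoint_near hL0 hs0 hdz
      obtain ⟨l, -, hl⟩ := hcon v hv
      refine ⟨l, fun _ => ?_, fun h => absurd h ht0, fun h => absurd h htL⟩
      have := (dist_triangle (x l) (testPoint L s v (x i)) (⟨z t, hz t ht⟩ : unitSquare)).trans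
        (add_le_add hl hvz)
      rw [← two_mul] at this
      exact this
    · exact ⟨i, fun h => absurd h ht, fun _ => rfl, fun h => absurd h htL⟩
  choose p hp hp0 hpL using hrep
  have hRpos : 0 < R := hs0.trans_le hsR
  have hhpos : 0 < h (x i) (x j) := (mul_pos hc₁ hRpos).trans_le (hd _ _).1
  obtain ⟨t, ht, hle⟩ := hT.exists_step_ge (fun a b => Real.rpow_nonneg (h0 _ _) _)
    (fun a b => by rw [hs]) hij (Real.rpow_pos_of_pos hhpos _) p L (hp0 0 rfl) (hpL L rfl)
  have h1 : h (x i) (x j) ≤ h (x (p t)) (x (p (t + 1))) :=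
    (Real.rpow_le_rpow_iff (h0 _ _) (h0 _ _) hα).1 hle
  have h2 : dist (z t) (z (t + 1)) = R / L := by
    simp only [z, dist_lineMap_lineMap, Real.dist_eq]
    have : (t : ℝ) / L - ((t + 1 : ℕ) : ℝ) / L = -(1 / L) := by push_cast; ring
    rw [this, abs_neg, abs_of_pos (by positivity)]
    change 1 / (L : ℝ) * R = R / L
    ring
  have h3 : dist (x (p t)) (x (p (t + 1))) ≤ 5 * (R / L) := by
    have e1 := hp t ht.le
    have e2 := hp (t + 1) ht
    rw [dist_comm] at e2
    have e3 := dist_triangle4 (x (p t) : EuclideanSpace ℝ (Fin 2)) (z t) (z (t + 1)) (x (p (t + 1)))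
    have e4 : s / L ≤ R / L := by gcongr
    rw [Subtype.dist_eq]
    linarith
  have h4 : c₁ * R ≤ c₂ * (5 * (R / L)) :=
    ((hd _ _).1.trans h1).trans ((hd _ _).2.trans (by gcongr))
  have h5 : c₂ * (5 * (R / L)) < c₁ * R := by
    have : c₂ * (5 * (R / L)) = 5 * c₂ * R / L := by ring
    rw [this, div_lt_iff₀ hL']
    nlinarith
  linarith

/-- Moving one node raises the weight of the minimum spanning tree by at most powers of
vacant radii. -/
theorem exists_mstWeight_update_le (hα : 0 < α) (hc₁ : 0 < c₁) (hc₂ : 0 < c₂) {L : ℕ}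
    (hL1 : 1 < L) (hL : 5 * c₂ < c₁ * L) :
    ∃ C : ℝ, 0 < C ∧ ∀ h : unitSquare → unitSquare → ℝ, (∀ x y, h x y = h y x) →
      (∀ x y, c₁ * dist x y ≤ h x y ∧ h x y ≤ c₂ * dist x y) →
      ∀ n : ℕ, 2 ≤ n → ∀ (x : Fin n → unitSquare) (i : Fin n) (y : unitSquare),
      ∃ R r : ℝ, IsVacantRadius L x i (x i) R ∧ IsVacantRadius L x i y r ∧
        mstWeight α h (Function.update x i y) ≤ mstWeight α h x + C * (R ^ α + r ^ α) := by
  classical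
  obtain ⟨C, hC, hpack⟩ := exists_sum_rpow_dist_le hα (div_pos hc₁ hc₂)
  refine ⟨(2 * c₂) ^ α * (C + 1), by positivity, ?_⟩
  intro h hs hd n hn x i y
  have h0 : ∀ a b, 0 ≤ h a b := fun a b => (by positivity : 0 ≤ c₁ * dist a b).trans (hd a b).1
  obtain ⟨T, hT, hTw⟩ := exists_isMinConnected (α := α) hs h0 (by omega) x
  have : Nontrivial (Fin n) := Fin.nontrivial_iff_two_le.2 hn
  obtain ⟨b, hb⟩ := hT.1.preconnected.exists_adj_of_nontrivial i
  set N := Finset.univ.filter fun b => T.Adj i b with hN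
  have hNne : N.Nonempty := ⟨b, by simp [hN, hb]⟩
  obtain ⟨j, hjN, hj⟩ := N.exists_min_image (fun b => dist (x b) (x i)) hNne
  obtain ⟨J, hJN, hJ⟩ := N.exists_max_image (fun b => dist (x b) (x i)) hNne
  have hNadj : ∀ b, b ∈ N ↔ T.Adj i b := fun b => by simp [hN]
  obtain ⟨k, hkmem, hk⟩ := (Finset.univ.filter fun l => l ≠ i).exists_min_image
    (fun l => dist (x l) y) ⟨b, by simp [hb.ne.symm]⟩
  have hki : k ≠ i := by simpa using hkmem
  refine ⟨dist (x i) (x J), dist (x k) y,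
    isVacantRadius_of_adj hα hc₁ hc₂ hs hd (by omega) hL hT ((hNadj J).1 hJN), ?_, ?_⟩
  · refine ⟨dist_nonneg, dist_unitSquare_lt_two _ _, fun s hs0 hsr _ => ⟨0, ?_, fun l hl => ?_⟩⟩
    · refine Fintype.mem_piFinset.2 fun c => Finset.mem_Icc.2 ?_
      simp
    · rw [testPoint_zero]
      have h1 : s / L < s := div_lt_self hs0 (by exact_mod_cast hL1)
      have h2 := hk l (by simpa using hl)
      linarith
  · obtain ⟨G, hG, hGw⟩ := exists_connected_relocate
      (w := fun a b => h (x a) (x b) ^ α)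
      (w' := fun a b => h (Function.update x i y a) (Function.update x i y b) ^ α)
      (fun a b => Real.rpow_nonneg (h0 _ _) _) (fun a b => Real.rpow_nonneg (h0 _ _) _)
      (fun a b => by rw [hs]) hT.1 ((hNadj j).1 hjN) hki
      (fun a b ha hb => by
        simp only [Function.update_of_ne ha, Function.update_of_ne hb])
    have hm := two_mul_mstWeight_le (α := α) hs h0 (by omega) (Function.update x i y) hG
    have hji : j ≠ i := ((hNadj j).1 hjN).ne.symm
    have hsum : (∑ b, if T.Adj i b ∧ b ≠ j then
        h (Function.update x i y j) (Function.update x i y b) ^ α else 0)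
        ≤ (2 * c₂) ^ α * ∑ b ∈ N, dist (x b) (x i) ^ α := by
      rw [Finset.mul_sum, hN, Finset.sum_filter]
      refine Finset.sum_le_sum fun b _ => ?_
      by_cases hbi : T.Adj i b
      · rw [if_pos hbi, ← Real.mul_rpow (by positivity) dist_nonneg]
        split_ifs
        · rw [Function.update_of_ne hji, Function.update_of_ne hbi.ne.symm]
          refine Real.rpow_le_rpow (h0 _ _) ((hd _ _).2.trans ?_) hα.le
          have h1 := hj b ((hNadj b).2 hbi)
          have h2 := dist_triangle_right (x j) (x b) (x i)
          nlinarith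
        · positivity
      · simp [hbi]
    have hpk := hpack (Fin n) N (fun b => (x b : EuclideanSpace ℝ (Fin 2))) (x i)
      (dist (x i) (x J)) dist_nonneg (fun b hb => by
        rw [dist_comm (x i)]
        exact hJ b hb) (fun a ha b hb hab => by
        have h1 := hT.le_of_adj_of_adj (fun a b => Real.rpow_nonneg (h0 _ _) _)
          (fun a b => by rw [hs]) ((hNadj a).1 ha) ((hNadj b).1 hb) hab
        have h2 : h (x i) (x a) ≤ h (x b) (x a) :=
          (Real.rpow_le_rpow_iff (h0 _ _) (h0 _ _) hα).1 h1
        have h3 := ((hd (x i) (x a)).1.trans h2).trans (hd (x b) (x a)).2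
        rw [div_mul_eq_mul_div, div_le_iff₀ hc₂, mul_comm _ c₂]
        rw [dist_comm (x i), dist_comm (x b)] at h3
        exact h3)
    have hlast : h (Function.update x i y i) (Function.update x i y k) ^ α
        ≤ (2 * c₂) ^ α * dist (x k) y ^ α := by
      rw [Function.update_self, Function.update_of_ne hki,
        ← Real.mul_rpow (by positivity) dist_nonneg]
      refine Real.rpow_le_rpow (h0 _ _) ((hd _ _).2.trans ?_) hα.le
      rw [dist_comm y]
      nlinarith [dist_nonneg (x := x k) (y := y)]
    have hA : 0 ≤ (2 * c₂) ^ α := by positivity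
    have hR : 0 ≤ dist (x i) (x J) ^ α := by positivity
    have hr : 0 ≤ dist (x k) y ^ α := by positivity
    have hfin : (2 * c₂) ^ α * ∑ b ∈ N, dist (x b) (x i) ^ α
        ≤ (2 * c₂) ^ α * (C * dist (x i) (x J) ^ α) := mul_le_mul_of_nonneg_left hpk hA
    have h6 : (2 * c₂) ^ α * (C + 1) * (dist (x i) (x J) ^ α + dist (x k) y ^ α)
        = (2 * c₂) ^ α * (C * dist (x i) (x J) ^ α) + (2 * c₂) ^ α * dist (x k) y ^ α
          + ((2 * c₂) ^ α * dist (x i) (x J) ^ α + (2 * c₂) ^ α * C * dist (x k) y ^ α) := by ring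
    have h7 : 0 ≤ (2 * c₂) ^ α * dist (x i) (x J) ^ α + (2 * c₂) ^ α * C * dist (x k) y ^ α := by
      positivity
    have h8 := hGw.trans (add_le_add_left (add_le_add_right (mul_le_mul_of_nonneg_left
      (le_of_eq_of_le (Finset.sum_congr rfl fun b _ => by congr) hsum) zero_le_two) _) _)
    linarith

/-- The effect of moving one node is controlled by the vacancies around its two positions. -/
theorem exists_sq_mstWeight_sub_update_le (hα : 0 < α) (hc₁ : 0 < c₁) (hc₂ : 0 < c₂) {L : ℕ}
    (hL1 : 1 < L) (hL : 5 * c₂ < c₁ * L) :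
    ∃ C : ℝ, 0 < C ∧ ∀ h : unitSquare → unitSquare → ℝ, (∀ x y, h x y = h y x) →
      (∀ x y, c₁ * dist x y ≤ h x y ∧ h x y ≤ c₂ * dist x y) →
      ∀ n : ℕ, 2 ≤ n → ∀ (x : Fin n → unitSquare) (i : Fin n) (y : unitSquare),
        (mstWeight α h x - mstWeight α h (Function.update x i y)) ^ 2
          ≤ C * (vacancySum α L x i (x i) + vacancySum α L x i y) := by
  obtain ⟨C, hC, H⟩ := exists_mstWeight_update_le hα hc₁ hc₂ hL1 hL
  refine ⟨2 * C ^ 2, by positivity, fun h hs hd n hn x i y => ?_⟩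
  have hsqrt : ∀ (x : Fin n → unitSquare) (z : unitSquare) (R : ℝ), IsVacantRadius L x i z R →
      R ^ α ≤ √(vacancySum α L x i z) := fun x z R hR =>
    Real.le_sqrt_of_sq_le (hR.rpow_sq_le hα (by omega))
  obtain ⟨R, r, hR, hr, h1⟩ := H h hs hd n hn x i y
  obtain ⟨R', r', hR', hr', h2⟩ := H h hs hd n hn (Function.update x i y) i (x i)
  rw [Function.update_idem, Function.update_eq_self] at h2
  have e1 := hsqrt _ _ _ hR
  have e2 := hsqrt _ _ _ hr
  have e3 := hsqrt _ _ _ hR'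
  have e4 := hsqrt _ _ _ hr'
  rw [vacancySum_update] at e3 e4
  rw [Function.update_self] at e3
  set a := √(vacancySum α L x i (x i)) with ha
  set b := √(vacancySum α L x i y) with hb
  have ha2 : a ^ 2 = vacancySum α L x i (x i) := Real.sq_sqrt (vacancySum_nonneg _ _ _ _ _)
  have hb2 : b ^ 2 = vacancySum α L x i y := Real.sq_sqrt (vacancySum_nonneg _ _ _ _ _)
  have habs : |mstWeight α h x - mstWeight α h (Function.update x i y)| ≤ C * (a + b) := by
    rw [abs_le]
    constructor <;> nlinarith
  have hsq : (mstWeight α h x - mstWeight α h (Function.update x i y)) ^ 2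
      ≤ (C * (a + b)) ^ 2 := by
    rw [← sq_abs]
    exact pow_le_pow_left₀ (abs_nonneg _) habs 2
  rw [← ha2, ← hb2]
  nlinarith [mul_nonneg (sq_nonneg C) (sq_nonneg (a - b))]

end Relocation

section EfronStein

variable {ι S : Type*}

/-- Swap the two components of the coordinates in `A`. -/
def swapOn (A : Set ι) [DecidablePred (· ∈ A)] (ω : ι → S × S) : ι → S × S :=
  fun i => if i ∈ A then (ω i).swap else ω i

variable [Fintype ι] [MeasurableSpace S] {μ : Measure S} [IsProbabilityMeasure μ]

theorem measurePreserving_swapOn (A : Set ι) [DecidablePred (· ∈ A)] :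
    MeasurePreserving (swapOn A) (Measure.pi fun _ : ι => μ.prod μ)
      (Measure.pi fun _ : ι => μ.prod μ) := by
  have h : ∀ i : ι, MeasurePreserving (fun p : S × S => if i ∈ A then p.swap else p)
      (μ.prod μ) (μ.prod μ) := by
    intro i
    by_cases hi : i ∈ A
    · simpa [hi] using Measure.measurePreserving_swap (μ := μ) (ν := μ)
    · simp only [hi, if_false]
      exact MeasurePreserving.id (μ.prod μ)
  exact measurePreserving_pi (fun _ => μ.prod μ) (fun _ => μ.prod μ) h

theorem MeasureTheory.MeasurePreserving.integral_comp_of_measurable {X Y : Type*}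
    [MeasurableSpace X] [MeasurableSpace Y] {ν : Measure X} {ν' : Measure Y} {φ : X → Y}
    (hφ : MeasurePreserving φ ν ν') {g : Y → ℝ} (hg : Measurable g) :
    ∫ x, g (φ x) ∂ν = ∫ y, g y ∂ν' := by
  rw [← hφ.map_eq, integral_map hφ.measurable.aemeasurable hg.aestronglyMeasurable]

variable (μ) in
theorem measurePreserving_fst_comp :
    MeasurePreserving (fun (ω : ι → S × S) i => (ω i).1) (Measure.pi fun _ : ι => μ.prod μ)
      (Measure.pi fun _ : ι => μ) :=
  measurePreserving_pi (fun _ => μ.prod μ) (fun _ => μ) fun _ => measurePreserving_fst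

theorem integral_fst_comp_mul_snd_comp {f : (ι → S) → ℝ} :
    ∫ ω, f (fun i => (ω i).1) * f (fun i => (ω i).2) ∂(Measure.pi fun _ : ι => μ.prod μ)
      = (∫ x, f x ∂(Measure.pi fun _ : ι => μ)) ^ 2 := by
  have h := measurePreserving_arrowProdEquivProdArrow S S ι (fun _ => μ) (fun _ => μ)
  have h1 := h.integral_comp' (fun p : (ι → S) × (ι → S) => f p.1 * f p.2)
  rw [integral_prod_mul f f, ← sq] at h1
  exact h1

/-- The Efron-Stein inequality for bounded functions. -/
theorem variance_pi_le_sum {n : ℕ} {f : (Fin n → S) → ℝ} (hf : Measurable f) {B : ℝ}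
    (hB : ∀ x, |f x| ≤ B) :
    variance f (Measure.pi fun _ : Fin n => μ) ≤ 1 / 2 * ∑ k : Fin n,
      ∫ ω, (f (fun i => (ω i).1) - f (Function.update (fun i => (ω i).1) k (ω k).2)) ^ 2
        ∂(Measure.pi fun _ : Fin n => μ.prod μ) := by
  classical
  set M := Measure.pi fun _ : Fin n => μ.prod μ with hM
  let F : (Fin n → S × S) → ℝ := fun ω => f fun i => (ω i).1
  have hfst : Measurable fun (ω : Fin n → S × S) i => (ω i).1 :=
    (measurePreserving_fst_comp (ι := Fin n) μ).measurable
  have hF : Measurable F := hf.comp hfst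
  let H : ℕ → (Fin n → S × S) → ℝ := fun k ω => F (swapOn {i : Fin n | i.1 < k} ω)
  have hH : ∀ k, Measurable (H k) := fun k =>
    hF.comp (measurePreserving_swapOn (μ := μ) _).measurable
  have hHB : ∀ k ω, |H k ω| ≤ B := fun k ω => hB _
  have hFB : ∀ ω, |F ω| ≤ B := fun ω => hB _
  have hint2 : ∀ g g' : (Fin n → S × S) → ℝ, Measurable g → Measurable g' →
      (∀ ω, |g ω| ≤ B) → (∀ ω, |g' ω| ≤ B) → Integrable (fun ω => g ω * g' ω) M := by
    intro g g' hg hg' hgB hgB'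
    refine Integrable.of_bound (hg.mul hg').aestronglyMeasurable (B * B)
      (Filter.Eventually.of_forall fun ω => ?_)
    rw [Real.norm_eq_abs, abs_mul]
    exact mul_le_mul (hgB ω) (hgB' ω) (abs_nonneg _) ((abs_nonneg _).trans (hgB ω))
  have hH0 : H 0 = F := by
    funext ω
    refine congrArg F (funext fun i => ?_)
    simp [swapOn]
  have hHn : ∀ ω, H n ω = f fun i => (ω i).2 := by
    intro ω
    simp [H, F, swapOn]
  have hvar : variance f (Measure.pi fun _ : Fin n => μ) = ∫ ω, F ω * H 0 ω ∂M
      - ∫ ω, F ω * H n ω ∂M := by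
    have hL2 : MemLp f 2 (Measure.pi fun _ : Fin n => μ) :=
      MemLp.of_bound hf.aestronglyMeasurable B (Filter.Eventually.of_forall hB)
    rw [variance_eq_sub hL2]
    congr 1
    · rw [hH0, sq f]
      exact ((measurePreserving_fst_comp (ι := Fin n) μ).integral_comp_of_measurable
        (hf.mul hf)).symm
    · simp only [hHn]
      exact (integral_fst_comp_mul_snd_comp (μ := μ) (f := f)).symm
  have hstep : ∀ k : Fin n, ∫ ω, F ω * H k ω ∂M - ∫ ω, F ω * H (k + 1) ω ∂M ≤ 1 / 2 *
      ∫ ω, (f (fun i => (ω i).1) - f (Function.update (fun i => (ω i).1) k (ω k).2)) ^ 2 ∂M := by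
    intro k
    let τ : (Fin n → S × S) → (Fin n → S × S) := swapOn {k}
    have hτ : MeasurePreserving τ M M := measurePreserving_swapOn _
    have hFτ : ∀ ω, F (τ ω) = f (Function.update (fun i => (ω i).1) k (ω k).2) := by
      intro ω
      refine congrArg f (funext fun i => ?_)
      by_cases hi : i = k
      · subst hi; simp [τ, swapOn]
      · simp [τ, swapOn, hi]
    have hFτm : Measurable fun ω => F (τ ω) := hF.comp hτ.measurable
    have hHτ : ∀ ω, H k (τ ω) = H (k + 1) ω := by
      intro ω
      refine congrArg F (funext fun i => ?_)
      rcases lt_trichotomy i k with hi | hi | hi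
      · simp [τ, swapOn, hi.ne, hi, hi.le]
      · subst hi; simp [τ, swapOn]
      · simp [τ, swapOn, hi.ne', hi.not_gt, hi.not_ge]
    have hHτ' : ∀ ω, H (k + 1) (τ ω) = H k ω := by
      intro ω
      have : τ (τ ω) = ω := by
        funext i
        by_cases hi : i = k <;> simp [τ, swapOn, hi]
      rw [← hHτ, this]
    have hHσ : ∀ ω, H (k + 1) ω = F (τ (swapOn {i : Fin n | i.1 < k.1} ω)) := by
      intro ω
      rw [← hHτ]
      refine congrArg F (funext fun i => ?_)
      by_cases hi : i = k
      · subst hi; simp [τ, swapOn]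
      · simp [τ, swapOn, hi]
    have e1 : ∫ ω, F ω * H k ω ∂M = ∫ ω, F (τ ω) * H (k + 1) ω ∂M := by
      have := hτ.integral_comp_of_measurable (g := fun ω => F ω * H k ω) (hF.mul (hH k))
      simp only [hHτ] at this
      exact this.symm
    have e2 : ∫ ω, F ω * H (k + 1) ω ∂M = ∫ ω, F (τ ω) * H k ω ∂M := by
      have := hτ.integral_comp_of_measurable (g := fun ω => F ω * H (k + 1) ω)
        (hF.mul (hH (k + 1)))
      simp only [hHτ'] at this
      exact this.symm
    have e3 : ∫ ω, (H k ω - H (k + 1) ω) ^ 2 ∂M = ∫ ω, (F ω - F (τ ω)) ^ 2 ∂M := by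
      simp only [hHσ]
      exact (measurePreserving_swapOn (μ := μ) {i : Fin n | i.1 < k.1}).integral_comp_of_measurable
        (g := fun ω => (F ω - F (τ ω)) ^ 2) ((hF.sub hFτm).pow_const 2)
    have i1 := hint2 _ _ hF (hH k) hFB (hHB k)
    have i2 := hint2 _ _ hF (hH (k + 1)) hFB (hHB (k + 1))
    have i3 := hint2 _ _ hFτm (hH k) (fun ω => hFB _) (hHB k)
    have i4 := hint2 _ _ hFτm (hH (k + 1)) (fun ω => hFB _) (hHB (k + 1))
    have i5 : Integrable (fun ω => (F ω - F (τ ω)) ^ 2) M := by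
      have : (fun ω => (F ω - F (τ ω)) ^ 2)
          = fun ω => F ω * F ω - 2 * (F ω * F (τ ω)) + F (τ ω) * F (τ ω) := by
        funext ω; ring
      rw [this]
      exact ((hint2 _ _ hF hF hFB hFB).sub
        ((hint2 _ _ hF hFτm hFB fun ω => hFB _).const_mul 2)).add
        (hint2 _ _ hFτm hFτm (fun ω => hFB _) fun ω => hFB _)
    have i6 : Integrable (fun ω => (H k ω - H (k + 1) ω) ^ 2) M := by
      have : (fun ω => (H k ω - H (k + 1) ω) ^ 2)
          = fun ω => H k ω * H k ω - 2 * (H k ω * H (k + 1) ω) + H (k + 1) ω * H (k + 1) ω := by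
        funext ω; ring
      rw [this]
      exact ((hint2 _ _ (hH k) (hH k) (hHB k) (hHB k)).sub
        ((hint2 _ _ (hH k) (hH (k + 1)) (hHB k) (hHB (k + 1))).const_mul 2)).add
        (hint2 _ _ (hH (k + 1)) (hH (k + 1)) (hHB (k + 1)) (hHB (k + 1)))
    have key : ∫ ω, ((F ω * H k ω - F ω * H (k + 1) ω) + (F (τ ω) * H (k + 1) ω - F (τ ω) * H k ω)) ∂M
        ≤ ∫ ω, (1 / 2 * (F ω - F (τ ω)) ^ 2 + 1 / 2 * (H k ω - H (k + 1) ω) ^ 2) ∂M := by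
      refine integral_mono ((i1.sub i2).add (i4.sub i3))
        ((i5.const_mul _).add (i6.const_mul _)) fun ω => ?_
      dsimp only
      nlinarith [sq_nonneg ((F ω - F (τ ω)) - (H k ω - H (k + 1) ω))]
    rw [integral_add (f := fun ω => F ω * H k ω - F ω * H (k + 1) ω)
        (g := fun ω => F (τ ω) * H (k + 1) ω - F (τ ω) * H k ω) (i1.sub i2) (i4.sub i3),
      integral_sub i1 i2, integral_sub i4 i3,
      integral_add (i5.const_mul _) (i6.const_mul _), integral_const_mul, integral_const_mul,
      e3, ← e1, ← e2] at key
    simp only [hFτ] at key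
    change _ ≤ 1 / 2 * ∫ ω, (F ω - f (Function.update (fun i => (ω i).1) k (ω k).2)) ^ 2 ∂M
    linarith
  rw [hvar, Finset.mul_sum]
  have htel : ∫ ω, F ω * H 0 ω ∂M - ∫ ω, F ω * H n ω ∂M
      = ∑ k : Fin n, (∫ ω, F ω * H k ω ∂M - ∫ ω, F ω * H (k + 1) ω ∂M) := by
    rw [Fin.sum_univ_eq_sum_range
      (fun k => ∫ ω, F ω * H k ω ∂M - ∫ ω, F ω * H (k + 1) ω ∂M) n,
      Finset.sum_range_sub' fun k => ∫ ω, F ω * H k ω ∂M]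
  rw [htel]
  exact Finset.sum_le_sum fun k _ => hstep k

end EfronStein

section Density

theorem le_squareMeasure_closedBall (p : unitSquare) {ρ : ℝ} (hρ0 : 0 ≤ ρ) (hρ : ρ ≤ 1) :
    ENNReal.ofReal (ρ ^ 2 / 4) ≤ squareMeasure (Metric.closedBall p ρ) := by
  let lo : Fin 2 → ℝ := fun c => max 0 ((p : EuclideanSpace ℝ (Fin 2)) c - ρ / 2)
  have hlo : ∀ c, 0 ≤ lo c ∧ lo c + ρ / 2 ≤ 1 ∧ (p : EuclideanSpace ℝ (Fin 2)) c - ρ / 2 ≤ lo c ∧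
      lo c ≤ (p : EuclideanSpace ℝ (Fin 2)) c := by
    intro c
    have h := p.2 c
    refine ⟨le_max_left _ _, ?_, le_max_right _ _, max_le h.1 (by linarith)⟩
    rcases max_cases 0 ((p : EuclideanSpace ℝ (Fin 2)) c - ρ / 2) with ⟨e, _⟩ | ⟨e, _⟩ <;>
      simp only [lo, e] <;> linarith [h.2]
  have hvol : volume ((WithLp.ofLp : EuclideanSpace ℝ (Fin 2) → _) ⁻¹'
      Set.Icc lo fun c => lo c + ρ / 2) = ENNReal.ofReal (ρ ^ 2 / 4) := by
    rw [(PiLp.volume_preserving_ofLp (Fin 2)).measure_preimage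
      measurableSet_Icc.nullMeasurableSet, Real.volume_Icc_pi, Fin.prod_univ_two,
      ← ENNReal.ofReal_mul (by linarith)]
    · congr 1; ring
  rw [squareMeasure, comap_subtype_coe_apply measurableSet_unitSquare, ← hvol]
  refine measure_mono fun z hz => ?_
  have hz' : ∀ c, lo c ≤ z c ∧ z c ≤ lo c + ρ / 2 := fun c => ⟨hz.1 c, hz.2 c⟩
  refine ⟨⟨z, fun c => ⟨(hlo c).1.trans (hz' c).1, (hz' c).2.trans (hlo c).2.1⟩⟩, ?_, rfl⟩
  refine dist_le_of_forall_coord hρ0 fun c => ?_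
  have h1 := hz' c
  have h2 := hlo c
  rw [abs_le]
  constructor <;> linarith

theorem withDensity_vacant_le {f : unitSquare → ℝ} {ε₁ : ℝ} (hε₁ : 0 < ε₁) (hf : ∀ x, ε₁ ≤ f x)
    [IsProbabilityMeasure (squareMeasure.withDensity fun x => ENNReal.ofReal (f x))]
    (p : unitSquare) {ρ : ℝ} (hρ0 : 0 ≤ ρ) (hρ : ρ ≤ 1) :
    squareMeasure.withDensity (fun x => ENNReal.ofReal (f x)) {y | ρ < dist y p}
      ≤ ENNReal.ofReal (Real.exp (-(ε₁ * (ρ ^ 2 / 4)))) := by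
  set ν := squareMeasure.withDensity fun x => ENNReal.ofReal (f x) with hν
  have hset : {y | ρ < dist y p} = (Metric.closedBall p ρ)ᶜ := by
    ext y; simp
  have h1 : ENNReal.ofReal (ε₁ * (ρ ^ 2 / 4)) ≤ ν (Metric.closedBall p ρ) := by
    rw [hν, withDensity_apply _ Metric.isClosed_closedBall.measurableSet,
      ENNReal.ofReal_mul hε₁.le]
    calc ENNReal.ofReal ε₁ * ENNReal.ofReal (ρ ^ 2 / 4)
        ≤ ENNReal.ofReal ε₁ * squareMeasure (Metric.closedBall p ρ) := by
          gcongr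
          exact le_squareMeasure_closedBall p hρ0 hρ
      _ = ∫⁻ _ in Metric.closedBall p ρ, ENNReal.ofReal ε₁ ∂squareMeasure := by
          rw [setLIntegral_const]
      _ ≤ _ := lintegral_mono fun x => ENNReal.ofReal_le_ofReal (hf x)
  rw [hset, prob_compl_eq_one_sub Metric.isClosed_closedBall.measurableSet]
  calc 1 - ν (Metric.closedBall p ρ) ≤ 1 - ENNReal.ofReal (ε₁ * (ρ ^ 2 / 4)) := by gcongr
    _ = ENNReal.ofReal (1 - ε₁ * (ρ ^ 2 / 4)) := by
        rw [ENNReal.ofReal_sub _ (by positivity), ENNReal.ofReal_one]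
    _ ≤ _ := ENNReal.ofReal_le_ofReal (by linarith [Real.add_one_le_exp (-(ε₁ * (ρ ^ 2 / 4)))])

end Density

section Probability

theorem measurableSet_hasVacantBall (L : ℕ) {n : ℕ} (i : Fin n) (s : ℝ) :
    MeasurableSet {x : Fin n → unitSquare | HasVacantBall L x i (x i) s} := by
  have : {x : Fin n → unitSquare | HasVacantBall L x i (x i) s}
      = ⋃ v ∈ offsets L, ⋂ l, ⋂ _ : l ≠ i,
        {x : Fin n → unitSquare | s / L < dist (x l) (testPoint L s v (x i))} := by
    ext x; simp [HasVacantBall]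
  rw [this]
  refine Finset.measurableSet_biUnion _ fun v _ => MeasurableSet.iInter fun l =>
    MeasurableSet.iInter fun _ => measurableSet_lt measurable_const ?_
  exact (measurable_pi_apply l).dist ((measurable_testPoint L s v).comp (measurable_pi_apply i))

/-- If every ball of radius `s / L` is missed with probability at most `q`, a vacant ball near
the point `x i` appears with probability at most a multiple of `q ^ (n - 1)`. -/
theorem pi_hasVacantBall_le {μ : Measure unitSquare} [IsProbabilityMeasure μ] {L : ℕ} {s : ℝ}
    {q : ENNReal} (hq : ∀ p, μ {y | s / L < dist y p} ≤ q) {m : ℕ} (i : Fin (m + 1)) :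
    Measure.pi (fun _ : Fin (m + 1) => μ) {x | HasVacantBall L x i (x i) s}
      ≤ (offsets L).card * q ^ m := by
  have hsub : {x : Fin (m + 1) → unitSquare | HasVacantBall L x i (x i) s}
      ⊆ ⋃ v ∈ offsets L, MeasurableEquiv.piFinSuccAbove (fun _ => unitSquare) i ⁻¹'
        {p | ∀ j, s / L < dist (p.2 j) (testPoint L s v p.1)} := by
    rintro x ⟨v, hv, h⟩
    exact Set.mem_biUnion hv fun j => h _ (Fin.succAbove_ne i j)
  refine (measure_mono hsub).trans ((measure_biUnion_finset_le _ _).trans ?_)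
  rw [← nsmul_eq_mul]
  refine Finset.sum_le_card_nsmul _ _ _ fun v _ => ?_
  have hmeas : MeasurableSet {p : unitSquare × (Fin m → unitSquare) |
      ∀ j, s / L < dist (p.2 j) (testPoint L s v p.1)} := by
    have : {p : unitSquare × (Fin m → unitSquare) |
        ∀ j, s / L < dist (p.2 j) (testPoint L s v p.1)}
        = ⋂ j, {p | s / L < dist (p.2 j) (testPoint L s v p.1)} := by
      ext p; simp
    rw [this]
    refine MeasurableSet.iInter fun j => measurableSet_lt measurable_const ?_
    exact ((measurable_pi_apply j).comp measurable_snd).dist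
      ((measurable_testPoint L s v).comp measurable_fst)
  rw [(measurePreserving_piFinSuccAbove (fun _ => μ) i).measure_preimage hmeas.nullMeasurableSet,
    Measure.prod_apply hmeas]
  calc _ ≤ ∫⁻ _, q ^ m ∂μ := by
        refine lintegral_mono fun z => ?_
        have : Prod.mk z ⁻¹' {p : unitSquare × (Fin m → unitSquare) |
            ∀ j, s / L < dist (p.2 j) (testPoint L s v p.1)}
            = Set.univ.pi fun _ => {y | s / L < dist y (testPoint L s v z)} := by
          ext y; simp
        rw [this, Measure.pi_pi, Finset.prod_const, Finset.card_univ, Fintype.card_fin]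
        gcongr
        exact hq _
    _ = q ^ m := by simp

theorem exists_sum_exp_le (α : ℝ) {b : ℝ} (hb : 0 < b) : ∃ D : ℝ, 0 ≤ D ∧ ∀ K : ℕ,
    ∑ k ∈ Finset.range K, (((2 : ℝ) ^ (k + 1)) ^ α) ^ 2 * Real.exp (-(b * 4 ^ k)) ≤ D := by
  obtain ⟨m, hm⟩ := exists_nat_ge α
  have hgeo := hasSum_geometric_of_lt_one (r := (1 / 4 : ℝ)) (by norm_num) (by norm_num)
  set A : ℝ := 4 ^ α * ((m + 1).factorial / b ^ (m + 1)) with hA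
  have hA0 : 0 ≤ A := by positivity
  refine ⟨A * (1 - 1 / 4)⁻¹, by positivity, fun K => ?_⟩
  have hterm : ∀ k : ℕ, (((2 : ℝ) ^ (k + 1)) ^ α) ^ 2 * Real.exp (-(b * 4 ^ k))
      ≤ A * (1 / 4) ^ k := by
    intro k
    have hu : (0 : ℝ) < 4 ^ k := by positivity
    have hu1 : (1 : ℝ) ≤ 4 ^ k := one_le_pow₀ (by norm_num)
    have e1 : (((2 : ℝ) ^ (k + 1)) ^ α) ^ 2 = 4 ^ α * ((4 : ℝ) ^ k) ^ α := by
      rw [← Real.mul_rpow (by norm_num) hu.le, sq, ← Real.mul_rpow (by positivity) (by positivity),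
        ← mul_pow]
      norm_num [pow_succ]
      ring_nf
    have e2 : ((4 : ℝ) ^ k) ^ α ≤ ((4 : ℝ) ^ k) ^ m := by
      rw [← Real.rpow_natCast _ m]
      exact Real.rpow_le_rpow_of_exponent_le hu1 hm
    have e3 : Real.exp (-(b * 4 ^ k)) ≤ (m + 1).factorial / (b * 4 ^ k) ^ (m + 1) := by
      have h1 := Real.pow_div_factorial_le_exp (b * 4 ^ k) (by positivity) (m + 1)
      rw [Real.exp_neg, ← inv_div]
      exact inv_anti₀ (by positivity) h1
    calc (((2 : ℝ) ^ (k + 1)) ^ α) ^ 2 * Real.exp (-(b * 4 ^ k))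
        ≤ 4 ^ α * ((4 : ℝ) ^ k) ^ m * ((m + 1).factorial / (b * 4 ^ k) ^ (m + 1)) := by
          rw [e1]
          gcongr
      _ = A * (1 / 4) ^ k := by
          rw [hA, mul_pow, pow_succ ((4 : ℝ) ^ k), one_div, inv_pow]
          field_simp
  calc _ ≤ ∑ k ∈ Finset.range K, A * (1 / 4 : ℝ) ^ k := Finset.sum_le_sum fun k _ => hterm k
    _ = A * ∑ k ∈ Finset.range K, (1 / 4 : ℝ) ^ k := by rw [Finset.mul_sum]
    _ ≤ _ := by
        refine mul_le_mul_of_nonneg_left ?_ hA0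
        exact sum_le_hasSum _ (fun _ _ => by positivity) hgeo

theorem measurable_vacancySum (α : ℝ) (L : ℕ) {n : ℕ} (i : Fin n) :
    Measurable fun x : Fin n → unitSquare => vacancySum α L x i (x i) := by
  classical
  unfold vacancySum
  refine measurable_const.mul (measurable_const.add (Finset.measurable_sum _ fun k _ => ?_))
  refine Measurable.ite ?_ measurable_const measurable_const
  exact MeasurableSet.inter (MeasurableSet.const _) (measurableSet_hasVacantBall L i _)

theorem vacancySum_le (α : ℝ) (L : ℕ) {n : ℕ} (i : Fin n) (x : Fin n → unitSquare)
    (z : unitSquare) : vacancySum α L x i z ≤ ((1 / √n) ^ α) ^ 2 *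
      (1 + ∑ k ∈ Finset.range (2 * n + 1), (((2 : ℝ) ^ (k + 1)) ^ α) ^ 2) := by
  classical
  unfold vacancySum
  gcongr with k _
  split_ifs
  · exact le_rfl
  · positivity

theorem integrable_vacancySum (α : ℝ) (L : ℕ) {n : ℕ} (i : Fin n)
    (ν : Measure (Fin n → unitSquare)) [IsProbabilityMeasure ν] :
    Integrable (fun x => vacancySum α L x i (x i)) ν := by
  refine Integrable.of_bound (measurable_vacancySum α L i).aestronglyMeasurable (((1 / √n) ^ α) ^ 2 *
      (1 + ∑ k ∈ Finset.range (2 * n + 1), (((2 : ℝ) ^ (k + 1)) ^ α) ^ 2)) (Filter.Eventually.of_forall fun x => ?_)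
  rw [Real.norm_eq_abs, abs_of_nonneg (vacancySum_nonneg _ _ _ _ _)]
  exact vacancySum_le α L i x _

theorem exists_integral_vacancySum_le (α : ℝ) {ε₁ : ℝ} (hε₁ : 0 < ε₁) {L : ℕ} (hL : 1 < L) :
    ∃ D : ℝ, 0 < D ∧ ∀ f : unitSquare → ℝ, (∀ x, ε₁ ≤ f x) → ∀ μ : Measure unitSquare,
      IsProbabilityMeasure μ → μ = squareMeasure.withDensity (fun x => ENNReal.ofReal (f x)) →
      ∀ n : ℕ, 2 ≤ n → ∀ i : Fin n,
        ∫ x, vacancySum α L x i (x i) ∂(Measure.pi fun _ : Fin n => μ)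
          ≤ D * ((1 / √n) ^ α) ^ 2 := by
  classical
  have hL0 : (0 : ℝ) < L := by exact_mod_cast (by omega : 0 < L)
  have hL2 : (2 : ℝ) ≤ L := by exact_mod_cast hL
  set b : ℝ := ε₁ / (8 * L ^ 2) with hb
  have hb0 : 0 < b := by positivity
  obtain ⟨D, hD0, hD⟩ := exists_sum_exp_le α hb0
  refine ⟨1 + (offsets L).card * D, by positivity, ?_⟩
  intro f hf μ hμ hμf n hn i
  set ν := Measure.pi fun _ : Fin n => μ with hν
  have hn0 : (0 : ℝ) < n := by exact_mod_cast (by omega : 0 < n)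
  have hprob : ∀ k : ℕ, ν.real {x | scale n k ≤ 2 ∧ HasVacantBall L x i (x i) (scale n k)}
      ≤ (offsets L).card * Real.exp (-(b * 4 ^ k)) := by
    intro k
    by_cases hk : scale n k ≤ 2
    swap
    · have : {x : Fin n → unitSquare | scale n k ≤ 2 ∧ HasVacantBall L x i (x i) (scale n k)}
          = ∅ := by ext x; simp [hk]
      rw [this, measureReal_empty]
      positivity
    have hset : {x : Fin n → unitSquare | scale n k ≤ 2 ∧ HasVacantBall L x i (x i) (scale n k)}
        = {x | HasVacantBall L x i (x i) (scale n k)} := by ext x; simp [hk]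
    rw [hset]
    have hsc0 : 0 ≤ scale n k := by unfold scale; positivity
    have hsc2 : scale n k ^ 2 = 4 ^ k / n := by
      rw [scale, div_pow, Real.sq_sqrt hn0.le, ← pow_mul, mul_comm, pow_mul]
      norm_num
    have hρ : scale n k / L ≤ 1 := by
      rw [div_le_one hL0]; linarith
    subst hμf
    have hq := fun p => withDensity_vacant_le hε₁ hf p (div_nonneg hsc0 hL0.le) hρ
    obtain ⟨m, rfl⟩ : ∃ m, n = m + 1 := ⟨n - 1, by omega⟩
    have hle := pi_hasVacantBall_le hq i
    have h2 : ν.real {x | HasVacantBall L x i (x i) (scale (m + 1) k)}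
        ≤ (offsets L).card * Real.exp (-(ε₁ * ((scale (m + 1) k / L) ^ 2 / 4))) ^ m := by
      refine ENNReal.toReal_le_of_le_ofReal (by positivity) (hle.trans_eq ?_)
      rw [ENNReal.ofReal_mul (by positivity), ENNReal.ofReal_natCast,
        ENNReal.ofReal_pow (by positivity)]
    refine h2.trans ?_
    gcongr
    rw [← Real.exp_nat_mul]
    refine Real.exp_le_exp.2 ?_
    have hm1 : (1 : ℝ) ≤ m := by exact_mod_cast (by omega : 1 ≤ m)
    have h3 : ((m + 1 : ℕ) : ℝ) ≤ 2 * m := by push_cast; linarith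
    have h4 : b * 4 ^ k ≤ m * (ε₁ * ((scale (m + 1) k / L) ^ 2 / 4)) := by
      rw [div_pow, hsc2, hb]
      have e : (m : ℝ) * (ε₁ * (4 ^ k / ((m + 1 : ℕ) : ℝ) / L ^ 2 / 4))
          = ε₁ / (8 * L ^ 2) * 4 ^ k * (2 * m / ((m + 1 : ℕ) : ℝ)) := by
        field_simp
        ring
      rw [e]
      refine le_mul_of_one_le_right (by positivity) ?_
      rwa [one_le_div hn0]
    linarith
  have hmeas : ∀ k : ℕ, MeasurableSet
      {x : Fin n → unitSquare | scale n k ≤ 2 ∧ HasVacantBall L x i (x i) (scale n k)} := fun k =>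
    MeasurableSet.inter (MeasurableSet.const _) (measurableSet_hasVacantBall L i _)
  have hterm : ∀ k : ℕ, (fun x : Fin n → unitSquare =>
      if scale n k ≤ 2 ∧ HasVacantBall L x i (x i) (scale n k)
        then (((2 : ℝ) ^ (k + 1)) ^ α) ^ 2 else 0)
      = Set.indicator {x | scale n k ≤ 2 ∧ HasVacantBall L x i (x i) (scale n k)}
        fun _ => (((2 : ℝ) ^ (k + 1)) ^ α) ^ 2 := by
    intro k
    funext x
    simp [Set.indicator_apply]
  have hint : ∀ k ∈ Finset.range (2 * n + 1), Integrable (fun x : Fin n → unitSquare =>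
      if scale n k ≤ 2 ∧ HasVacantBall L x i (x i) (scale n k)
        then (((2 : ℝ) ^ (k + 1)) ^ α) ^ 2 else 0) ν := by
    intro k _
    rw [hterm]
    exact (integrable_const _).indicator (hmeas k)
  unfold vacancySum
  rw [integral_const_mul, integral_add (integrable_const _) (integrable_finsetSum _ hint),
    integral_finsetSum _ hint, integral_const, probReal_univ, one_smul, mul_comm]
  gcongr
  calc _ ≤ ∑ k ∈ Finset.range (2 * n + 1), (offsets L).card *
        ((((2 : ℝ) ^ (k + 1)) ^ α) ^ 2 * Real.exp (-(b * 4 ^ k))) := by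
        refine Finset.sum_le_sum fun k _ => ?_
        rw [hterm, integral_indicator_const _ (hmeas k), smul_eq_mul]
        calc _ ≤ (offsets L).card * Real.exp (-(b * 4 ^ k)) * (((2 : ℝ) ^ (k + 1)) ^ α) ^ 2 := by
              gcongr
              exact hprob k
          _ = _ := by ring
    _ ≤ _ := by
        rw [← Finset.mul_sum]
        gcongr
        exact hD _

end Probability

section Main

variable {α c₂ : ℝ} {h : unitSquare → unitSquare → ℝ}

theorem measurable_mstWeight (hm : Measurable (Function.uncurry h)) {n : ℕ} (hn : 1 ≤ n) :
    Measurable fun x : Fin n → unitSquare => mstWeight α h x := by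
  classical
  refine measurable_of_Iio fun a => ?_
  have hset : (fun x : Fin n → unitSquare => mstWeight α h x) ⁻¹' Set.Iio a
      = ⋃ T : {T : SimpleGraph (Fin n) // T.IsTree}, {x | graphWeight α h x T < a} := by
    ext x
    simp only [Set.mem_preimage, Set.mem_Iio, Set.mem_iUnion, Set.mem_ofPred_eq]
    constructor
    · intro hx
      obtain ⟨T, hT, hTe⟩ := (mstWeight_isLeast α h hn x).1
      exact ⟨⟨T, hT⟩, by rwa [hTe]⟩
    · rintro ⟨⟨T, hT⟩, hx⟩
      exact ((mstWeight_isLeast α h hn x).2 ⟨T, hT, rfl⟩).trans_lt hx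
  rw [hset]
  refine MeasurableSet.iUnion fun T => measurableSet_lt ?_ measurable_const
  unfold graphWeight
  refine Finset.measurable_sum _ fun i _ => Finset.measurable_sum _ fun j _ => ?_
  split_ifs
  · have hij : Measurable fun x : Fin n → unitSquare => (x i, x j) :=
      (measurable_pi_apply i).prodMk (measurable_pi_apply j)
    exact (hm.comp hij).pow_const α
  · exact measurable_const

theorem abs_mstWeight_le (hα : 0 < α) (hc₂ : 0 < c₂) (h0 : ∀ x y, 0 ≤ h x y)
    (hd : ∀ x y, h x y ≤ c₂ * dist x y) {n : ℕ} (hn : 1 ≤ n) (x : Fin n → unitSquare) :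
    |mstWeight α h x| ≤ ∑ _i : Fin n, ∑ _j : Fin n, (c₂ * 2) ^ α := by
  classical
  obtain ⟨T, -, hTe⟩ := (mstWeight_isLeast α h hn x).1
  rw [← hTe, graphWeight, abs_of_nonneg]
  · refine Finset.sum_le_sum fun i _ => Finset.sum_le_sum fun j _ => ?_
    split_ifs
    · refine Real.rpow_le_rpow (h0 _ _) ((hd _ _).trans ?_) hα.le
      exact mul_le_mul_of_nonneg_left (dist_unitSquare_lt_two _ _).le hc₂.le
    · positivity
  · refine Finset.sum_nonneg fun i _ => Finset.sum_nonneg fun j _ => ?_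
    split_ifs
    exacts [Real.rpow_nonneg (h0 _ _) _, le_rfl]

end Main

theorem theorem2 (α c₁ c₂ ε₁ ε₂ : ℝ) (hα : 0 < α) (hc₁ : 0 < c₁) (hc₂ : 0 < c₂)
    (hε₁ : 0 < ε₁) (hε : ε₁ ≤ ε₂) :
    ∃ D₁ : ℝ, 0 < D₁ ∧ ∃ n₀ : ℕ,
      ∀ (f : unitSquare → ℝ), Measurable f → (∀ x, ε₁ ≤ f x ∧ f x ≤ ε₂) →
      ∀ (h : unitSquare → unitSquare → ℝ), Measurable (Function.uncurry h) →
        (∀ x y, h x y = h y x) →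
        (∀ x y, c₁ * dist x y ≤ h x y ∧ h x y ≤ c₂ * dist x y) →
      ∀ (Ω : Type*) [MeasurableSpace Ω] (P : Measure Ω) [IsProbabilityMeasure P]
        (X : ℕ → Ω → unitSquare), (∀ i, Measurable (X i)) → iIndepFun X P →
        (∀ i, P.map (X i) = squareMeasure.withDensity (fun x => ENNReal.ofReal (f x))) →
      ∀ n : ℕ, n₀ ≤ n →
        MemLp (fun ω => mstWeight α h (fun i : Fin n => X i ω)) 2 P ∧
        variance (fun ω => mstWeight α h (fun i : Fin n => X i ω)) P ≤ D₁ * (n : ℝ) ^ (1 - α) := by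
  obtain ⟨L', hL'⟩ := exists_nat_gt (5 * c₂ / c₁)
  set L := max 2 L' with hLdef
  have hL1 : 1 < L := (by norm_num : 1 < 2).trans_le (le_max_left 2 L')
  have hL : 5 * c₂ < c₁ * L := by
    rw [div_lt_iff₀' hc₁] at hL'
    refine hL'.trans_le (mul_le_mul_of_nonneg_left ?_ hc₁.le)
    exact_mod_cast le_max_right 2 L'
  obtain ⟨C, hC, hdiff⟩ := exists_sq_mstWeight_sub_update_le hα hc₁ hc₂ hL1 hL
  obtain ⟨D, hD, hvac⟩ := exists_integral_vacancySum_le α hε₁ hL1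
  refine ⟨C * D, by positivity, 2, ?_⟩
  intro f _ hf h hm hs hd Ω _ P _ X hX hind hlaw n hn
  have h0 : ∀ a b, 0 ≤ h a b := fun a b => (by positivity : 0 ≤ c₁ * dist a b).trans (hd a b).1
  set μ := squareMeasure.withDensity (fun x => ENNReal.ofReal (f x)) with hμ
  have hμP : IsProbabilityMeasure μ := by
    rw [← hlaw 0]
    exact Measure.isProbabilityMeasure_map (hX 0).aemeasurable
  have hn0 : (0 : ℝ) < n := by exact_mod_cast (by omega : 0 < n)
  have hmst : Measurable fun x : Fin n → unitSquare => mstWeight α h x :=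
    measurable_mstWeight hm (by omega)
  have hbd := abs_mstWeight_le (n := n) hα hc₂ h0 (fun x y => (hd x y).2) (by omega)
  have hXm : Measurable fun ω (i : Fin n) => X i ω := measurable_pi_lambda _ fun i => hX i
  have hmap : P.map (fun ω (i : Fin n) => X i ω) = Measure.pi fun _ : Fin n => μ := by
    have h1 := (iIndepFun_iff_map_fun_eq_pi_map (fun i : Fin n => (hX i).aemeasurable)).1
      (hind.precomp Fin.val_injective)
    rw [h1]
    exact congrArg Measure.pi (funext fun i => hlaw i)
  refine ⟨MemLp.of_bound (hmst.comp hXm).aestronglyMeasurable _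
    (Filter.Eventually.of_forall fun ω => hbd _), ?_⟩
  have hvar : variance (fun ω => mstWeight α h (fun i : Fin n => X i ω)) P
      = variance (fun x : Fin n → unitSquare => mstWeight α h x)
        (Measure.pi fun _ : Fin n => μ) := by
    rw [← hmap, variance_map hmst.aemeasurable hXm.aemeasurable]
    rfl
  rw [hvar]
  refine (variance_pi_le_sum hmst hbd).trans ?_
  set M := Measure.pi fun _ : Fin n => μ.prod μ with hM
  have hpow : (n : ℝ) ^ (1 - α) = n * ((1 / √n) ^ α) ^ 2 := by
    rw [← Real.rpow_natCast ((1 / √n) ^ α) 2, ← Real.rpow_mul (by positivity), mul_comm α,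
      Real.rpow_mul (by positivity), Real.rpow_natCast, div_pow, Real.sq_sqrt hn0.le, one_pow,
      one_div, Real.inv_rpow hn0.le, Real.rpow_sub hn0, Real.rpow_one, div_eq_mul_inv]
  have hone : ∀ k : Fin n, ∫ ω, (mstWeight α h (fun i => (ω i).1)
      - mstWeight α h (Function.update (fun i => (ω i).1) k (ω k).2)) ^ 2 ∂M
      ≤ 2 * (C * D) * ((1 / √n) ^ α) ^ 2 := by
    intro k
    have hfst := measurePreserving_fst_comp (ι := Fin n) μ
    have hτ : MeasurePreserving (swapOn {k}) M M := measurePreserving_swapOn _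
    let V : (Fin n → unitSquare × unitSquare) → ℝ := fun ω =>
      vacancySum α L (fun i => (ω i).1) k (ω k).1
    have hV : Measurable V := (measurable_vacancySum α L k).comp hfst.measurable
    have hVint : Integrable V M :=
      hfst.integrable_comp_of_integrable (integrable_vacancySum α L k _)
    have hVτ : ∀ ω, V (swapOn {k} ω) = vacancySum α L (fun i => (ω i).1) k (ω k).2 := by
      intro ω
      have e : (fun i => (swapOn {k} ω i).1) = Function.update (fun i => (ω i).1) k (ω k).2 := by
        funext i
        by_cases hi : i = k
        · subst hi; simp [swapOn]
        · simp [swapOn, hi]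
      simp only [V, e, vacancySum_update]
      simp [swapOn]
    have hVle : ∫ ω, V ω ∂M ≤ D * ((1 / √n) ^ α) ^ 2 := by
      have h1 := hvac f (fun x => (hf x).1) μ hμP rfl n hn k
      rwa [← hfst.integral_comp_of_measurable (measurable_vacancySum α L k)] at h1
    have hVτint : Integrable (fun ω => V (swapOn {k} ω)) M :=
      hτ.integrable_comp_of_integrable hVint
    calc _ ≤ ∫ ω, C * (V ω + V (swapOn {k} ω)) ∂M := by
          refine integral_mono_of_nonneg (Filter.Eventually.of_forall fun ω => sq_nonneg _)
            ((hVint.add hVτint).const_mul C) (Filter.Eventually.of_forall fun ω => ?_)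
          dsimp only
          rw [hVτ]
          exact hdiff h hs hd n hn _ k _
      _ = C * (2 * ∫ ω, V ω ∂M) := by
          rw [integral_const_mul, integral_add hVint hVτint,
            hτ.integral_comp_of_measurable hV, two_mul]
      _ ≤ C * (2 * (D * ((1 / √n) ^ α) ^ 2)) := by gcongr
      _ = _ := by ring
  calc _ ≤ 1 / 2 * ∑ _k : Fin n, 2 * (C * D) * ((1 / √n) ^ α) ^ 2 := by
        gcongr with k
        exact hone k
    _ = _ := by
        rw [Finset.sum_const, Finset.card_univ, Fintype.card_fin, nsmul_eq_mul, hpow]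
        ring
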